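/- Let $m \ge 1$ and let $\Gamma \le S_m$ be a subgroup. For $n \ge 1$ let $\Gamma^n \rtimes S_n$ be the group of permutations of $n$ blocks of size $m$ consisting of the elements $(g_1,\dots,g_n;h)$, $g_i\in\Gamma$, $h\in S_n$, which permute the $i$-th block by $g_i$ for each $i$ and then permute the blocks by $h$. A partition of unity is a nonincreasing sequence $x_1\ge x_2\ge\dots\ge 0$ with $\sum_i x_i=1$; its $k$-th part is $x_k$, with $x_0=\infty$. Let $\mathcal B=(\mathcal B_1,\mathcal B_2,\dots)$ be the random partition of unity formed by the cycle lengths (fixed points included), divided by $m$, of a uniform element of $\Gamma$, sorted in nonincreasing order and padded with zeros. There is exactly one law of a random partition of unity $\mathcal A$ such that $$\mathcal A \overset{d}{=} (U\mathcal B,\,(1-U)\mathcal A),$$ where on the right $U$ is uniform on $[0,1]$, the variables $U,\mathcal B,\mathcal A$ are independent, and the parts of $U\mathcal B$ and of $(1-U)\mathcal A$ together are sorted in nonincreasing order. Let $\mathcal A$ have this law and, for $k\ge 1$ and $u\ge 0$, put $\phi_k(u)=\mathbb P(\mathcal A_k\le 1/u)$, with $1/0=\infty$ and $1/\infty=0$.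 Then for every $k\ge1$: 1. If $\pi$ is uniform in $\Gamma^n\rtimes S_n$ and $C_k$ is the length of the $k$-th largest cycle of $\pi$ (with $C_k=0$ if $\pi$ has fewer than $k$ cycles), then $C_k/(mn)$ converges in distribution to $\mathcal A_k$ as $n\to\infty$. 2. $\phi_k(u)=1$ for $u\in[0,1]$, and for every $u>0$ $$\phi_k(u)=\frac1u\sum_{j=0}^{k-1}\mathbb E_{\mathcal B}\int_{(u-1/\mathcal B_{j+1})\vee 0}^{(u-1/\mathcal B_j)\vee 0}\phi_{k-j}(y)\,dy ,$$ and, equivalently, $$u\,\phi_k(u)=\sum_{j=0}^{k-1}\int_0^u S_j(x)\,\phi_{k-j}(u-x)\,dx,\qquad S_j(x)=\mathbb P(\mathcal B_{j+1}\le 1/x<\mathcal B_j).$$ -/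

import Mathlib

open MeasureTheory ProbabilityTheory Filter Topology
open scoped ENNReal

namespace WreathCycles

/-! ### Ranking and partitions of unity -/

/-- The `k`-th largest term (`k = 1, 2, …`) of a family `a` of nonnegative numbers, counted with
multiplicity: the least `t` such that fewer than `k` terms exceed `t`. It is `0` if the family has
fewer than `k` positive terms, and it is `∞` for `k = 0`. -/
noncomputable def kthLargest {ι : Type*} (a : ι → ℝ≥0∞) (k : ℕ) : ℝ≥0∞ :=
  sInf {t : ℝ≥0∞ | {i | t < a i}.encard < k}

/-- The nonincreasing rearrangement of a family: its largest term, its second largest term, … -/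
noncomputable def ranked {ι : Type*} (a : ι → ℝ≥0∞) : ℕ → ℝ≥0∞ :=
  fun j => kthLargest a (j + 1)

/-- Partitions of unity: nonincreasing sequences of nonnegative numbers with sum `1`. -/
def partitionsOfUnity : Set (ℕ → ℝ≥0∞) :=
  {x | Antitone x ∧ ∑' i, x i = 1}

theorem kthLargest_le_iff {ι : Type*} (a : ι → ℝ≥0∞) (k : ℕ) (hk : 0 < k) (t : ℝ≥0∞) :
    kthLargest a k ≤ t ↔ {i | t < a i}.encard < k := by
  constructor
  · intro h
    by_contra hcon
    rw [not_lt] at hcon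
    obtain ⟨s, hs, hsk⟩ := Set.exists_subset_encard_eq hcon
    have hfin : s.Finite := Set.finite_of_encard_eq_coe hsk
    have hne : s.Nonempty := by
      rw [← Set.encard_pos, hsk]
      exact_mod_cast hk
    obtain ⟨i₀, hi₀, hmin⟩ := hfin.exists_minimalFor a s hne
    have hle : a i₀ ≤ kthLargest a k := by
      refine le_sInf fun r hr => ?_
      by_contra hra
      rw [not_le] at hra
      have hsub : s ⊆ {i | r < a i} := by
        intro i hi
        rcases le_total (a i₀) (a i) with h1 | h1
        · exact hra.trans_le h1
        · exact hra.trans_le (hmin hi h1)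
      have h2 := Set.encard_le_encard hsub
      rw [hsk] at h2
      exact absurd hr (not_lt.mpr h2)
    exact absurd (hs hi₀) (not_lt.mpr (hle.trans h))
  · intro h
    exact sInf_le h

theorem kthLargest_zero {ι : Type*} (a : ι → ℝ≥0∞) : kthLargest a 0 = ∞ := by
  simp [kthLargest]

/-- The `k`-th largest term is a measurable function of a countable family. -/
theorem measurable_kthLargest {ι : Type*} [Countable ι] (k : ℕ) :
    Measurable fun a : ι → ℝ≥0∞ => kthLargest a k := by
  rcases Nat.eq_zero_or_pos k with rfl | hk
  · simp only [kthLargest_zero]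
    exact measurable_const
  refine measurable_of_Iic fun t => ?_
  have h : (fun a : ι → ℝ≥0∞ => kthLargest a k) ⁻¹' Set.Iic t
      = (⋃ s ∈ {s : Finset ι | s.card = k}, ⋂ i ∈ s, {a : ι → ℝ≥0∞ | t < a i})ᶜ := by
    ext a
    simp only [Set.mem_preimage, Set.mem_Iic, kthLargest_le_iff a k hk, Set.mem_compl_iff,
      Set.mem_iUnion, Set.mem_iInter, Set.mem_ofPred_eq, exists_prop, not_exists, not_and]
    constructor
    · intro hlt s hs hall
      have h1 : ((s : Set ι)).encard ≤ {i | t < a i}.encard :=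
        Set.encard_le_encard fun i hi => hall i hi
      rw [Set.encard_coe_eq_coe_finsetCard, hs] at h1
      exact absurd hlt (not_lt.mpr h1)
    · intro hall
      by_contra hcon
      rw [not_lt] at hcon
      obtain ⟨s, hs, hsk⟩ := Set.exists_subset_encard_eq hcon
      have hfin : s.Finite := Set.finite_of_encard_eq_coe hsk
      refine hall hfin.toFinset ?_ fun i hi => hs (hfin.mem_toFinset.mp hi)
      have h2 := hfin.encard_eq_coe_toFinset_card
      rw [hsk] at h2
      exact_mod_cast h2.symm
  rw [h]
  refine (MeasurableSet.biUnion (Set.to_countable _) fun s _ => ?_).compl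
  exact s.measurableSet_biInter fun i _ => measurableSet_lt measurable_const (measurable_pi_apply i)

/-! ### The distributional identity `𝒜 = (U ℬ, (1 - U) 𝒜)` -/

/-- The partition `(u b, (1 - u) a)`: the parts of `b` scaled by `u` together with the parts of
`a` scaled by `1 - u`, sorted in nonincreasing order. -/
noncomputable def splice (u : unitInterval) (b a : ℕ → ℝ≥0∞) : ℕ → ℝ≥0∞ :=
  ranked (Sum.elim (fun i => ENNReal.ofReal u * b i) (fun i => ENNReal.ofReal (1 - u) * a i))

theorem measurable_splice :
    Measurable fun p : unitInterval × (ℕ → ℝ≥0∞) × (ℕ → ℝ≥0∞) => splice p.1 p.2.1 p.2.2 := by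
  refine measurable_pi_lambda _ fun j => (measurable_kthLargest (j + 1)).comp ?_
  refine measurable_pi_lambda _ fun i => ?_
  rcases i with i | i
  · simp only [Sum.elim_inl]
    fun_prop
  · simp only [Sum.elim_inr]
    fun_prop

/-- `𝒜` is the law of a random partition of unity satisfying `𝒜 = (U ℬ, (1 - U) 𝒜)` in
distribution, where on the right-hand side `U` is uniform on `[0, 1]`, `ℬ` has law `β`, and
`U`, `ℬ`, `𝒜` are independent. -/
def IsSelfSimilarPartition (β : Measure (ℕ → ℝ≥0∞)) (𝒜 : ProbabilityMeasure (ℕ → ℝ≥0∞)) : Prop :=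
  (∀ᵐ a ∂(𝒜 : Measure (ℕ → ℝ≥0∞)), a ∈ partitionsOfUnity) ∧
    (𝒜 : Measure (ℕ → ℝ≥0∞)) =
      ((volume : Measure unitInterval).prod (β.prod (𝒜 : Measure (ℕ → ℝ≥0∞)))).map
        fun p => splice p.1 p.2.1 p.2.2

/-- `φ_k(u) = P(𝒜_k ≤ 1 / u)` for `u ≥ 0`, with `1 / 0 = ∞`. -/
noncomputable def phi (𝒜 : ProbabilityMeasure (ℕ → ℝ≥0∞)) (k : ℕ) (u : ℝ) : ℝ :=
  (𝒜 : Measure (ℕ → ℝ≥0∞)).real {a | kthLargest a k ≤ 1 / ENNReal.ofReal u}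

/-! ### Cycles of permutations and wreath products -/

/-- The cycles of a permutation, fixed points included, i.e. its orbits. -/
abbrev Cycles {α : Type*} (σ : Equiv.Perm α) : Type _ :=
  Quotient (Equiv.Perm.SameCycle.setoid σ)

/-- The length of a cycle. -/
noncomputable def cycleLength {α : Type*} (σ : Equiv.Perm α) (c : Cycles σ) : ℕ :=
  Nat.card {x : α // Quotient.mk (Equiv.Perm.SameCycle.setoid σ) x = c}

/-- The length of the `k`-th largest cycle of `σ` (`0` if there are fewer than `k` cycles). -/
noncomputable def kthCycle {α : Type*} (σ : Equiv.Perm α) (k : ℕ) : ℝ≥0∞ :=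
  kthLargest (fun c : Cycles σ => (cycleLength σ c : ℝ≥0∞)) k

/-- The nonincreasing sequence of normalized cycle lengths of a permutation of `α`, padded with
zeros. -/
noncomputable def cyclePartition {α : Type*} (σ : Equiv.Perm α) : ℕ → ℝ≥0∞ :=
  ranked fun c : Cycles σ => (cycleLength σ c : ℝ≥0∞) / Nat.card α

instance permMeasurableSpace (α : Type*) : MeasurableSpace (Equiv.Perm α) := ⊤

instance permDiscreteMeasurableSpace (α : Type*) : DiscreteMeasurableSpace (Equiv.Perm α) :=
  ⟨fun _ => trivial⟩

instance isProbabilityMeasure_uniformOn_subgroup {α : Type*} [Finite α]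
    (G : Subgroup (Equiv.Perm α)) :
    IsProbabilityMeasure (uniformOn (G : Set (Equiv.Perm α))) :=
  isProbabilityMeasure_uniformOn (Set.toFinite _) ⟨1, G.one_mem⟩

/-- The wreath product `Γⁿ ⋊ S_n` as a group of permutations of `n` blocks of size `m`:
`(g₁, …, g_n; h)` first permutes the `i`-th block by `g_i ∈ Γ`, for each `i`, and then permutes
the blocks by `h`. -/
def wreathProduct {m : ℕ} (Γ : Subgroup (Equiv.Perm (Fin m))) (n : ℕ) :
    Subgroup (Equiv.Perm (Fin n × Fin m)) where
  carrier := {σ | ∃ (g : Fin n → Γ) (h : Equiv.Perm (Fin n)),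
    ∀ i x, σ (i, x) = (h i, (g i : Equiv.Perm (Fin m)) x)}
  one_mem' := ⟨1, 1, fun _ _ => rfl⟩
  mul_mem' := by
    rintro σ τ ⟨g, h, hσ⟩ ⟨g', h', hτ⟩
    refine ⟨fun i => g (h' i) * g' i, h * h', fun i x => ?_⟩
    rw [Equiv.Perm.mul_apply, hτ, hσ]
    rfl
  inv_mem' := by
    rintro σ ⟨g, h, hσ⟩
    refine ⟨fun i => (g (h⁻¹ i))⁻¹, h⁻¹, fun i x => ?_⟩
    rw [Equiv.Perm.inv_eq_iff_eq, hσ]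
    simp

end WreathCycles

open WreathCycles

/-!
The cycle of blocks that contains a fixed block of a uniform `π ∈ Γⁿ ⋊ S_n` has a uniform length
`ℓ ∈ {1, …, n}`. The product of the `g_i` around it is uniform in `Γ`, so the cycles of `π` in these
blocks are `ℓ` times the cycles of a uniform element of `Γ`, and the remaining `n - ℓ` blocks carry
an independent uniform element of `Γ^(n - ℓ) ⋊ S_(n - ℓ)`. So the sorted sequence `Y_n` of cycle
lengths, in units of the block size, satisfies `Y_n = (ℓ ℬ, Y_(n - ℓ))` in distribution
(`IsSplitRecursion`, `isSplitRecursion_cycleLaw`). This is proved by contracting the distinguished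
block into the block it is mapped to, one block at a time (`countAbove_blockWeights_some`), with a
weight that remembers how many blocks have been contracted.

This recursion is the discrete form of `𝒜 = (U ℬ, (1 - U) 𝒜)`, with `ℓ / n` in place of `U`. Sorting
does not increase the `ℓ¹` distance (`tsum_ranked_tsub_le`, from the layer-cake formula), so `n 𝒜` and
`Y_n` can be compared through bounded functions that are `1`-Lipschitz in `ℓ¹` (`IsTest`). If `e_n`
is the largest difference of their expectations, then `e_n ≤ 2 + (e_0 + ⋯ + e_(n - 1)) / n`, where `2`
is the cost of replacing `n U` by an integer. Hence `e_n ≤ 2 (1 + 1 / 2 + ⋯ + 1 / n)`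
(`IsSplitRecursion.abs_integral_sub_le`), which is negligible after division by `n`. This gives the
convergence in distribution, and it gives uniqueness of the law of `𝒜`, since any solution is the
limit of the rescaled `Y_n`. Existence is stick breaking: the parts of `U_i ℬ_i`, scaled by what is
left after the first steps, exhaust the mass because the expected mass `M` satisfies
`M = 1 / 2 + M / 2` (`exists_isSelfSimilarPartition`).

For the recursion of `φ_k`, the number of parts of `(U ℬ, (1 - U) 𝒜)` above `1 / u` is the number of
parts of `ℬ` above `1 / (u U)` plus the number of parts of `𝒜` above `1 / (u (1 - U))`. Decomposing
along the first number and substituting `x = u U` gives the convolution form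
(`IsSelfSimilarPartition.mul_phi_eq`); Fubini's theorem and `y = u - x` give the other form
(`integral_between_mul_eq`).
-/

namespace WreathCycles

/-! ### Ranking a family -/

/-- The number of terms of the family `a` that exceed `t`. The ranked family depends on `a` only
through this function. -/
noncomputable def countAbove {ι : Type*} (a : ι → ℝ≥0∞) (t : ℝ≥0∞) : ℕ∞ :=
  {i | t < a i}.encard

/-- The ranked family obtained by putting together the terms of `b` and those of `a`. It is
irreducible so that unification does not unfold the ranking. -/
@[irreducible] noncomputable def merge {ι κ : Type*} (b : ι → ℝ≥0∞) (a : κ → ℝ≥0∞) : ℕ → ℝ≥0∞ :=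
  ranked (Sum.elim b a)

theorem lt_kthLargest_iff {ι : Type*} (a : ι → ℝ≥0∞) {k : ℕ} (hk : 0 < k) (t : ℝ≥0∞) :
    t < kthLargest a k ↔ (k : ℕ∞) ≤ countAbove a t := by
  rw [← not_le, kthLargest_le_iff a k hk, not_lt, countAbove]

theorem kthLargest_congr {ι κ : Type*} {a : ι → ℝ≥0∞} {b : κ → ℝ≥0∞}
    (h : ∀ t, countAbove a t = countAbove b t) (k : ℕ) : kthLargest a k = kthLargest b k := by
  have h' : ∀ t, {i | t < a i}.encard = {i | t < b i}.encard := h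
  simp only [kthLargest, h']

theorem ranked_congr {ι κ : Type*} {a : ι → ℝ≥0∞} {b : κ → ℝ≥0∞}
    (h : ∀ t, countAbove a t = countAbove b t) : ranked a = ranked b :=
  funext fun j => kthLargest_congr h (j + 1)

theorem encard_setOf_succ_le (N : ℕ∞) : {j : ℕ | ((j + 1 : ℕ) : ℕ∞) ≤ N}.encard = N := by
  induction N using ENat.recTopCoe with
  | top => simp
  | coe n =>
    have : {j : ℕ | ((j + 1 : ℕ) : ℕ∞) ≤ (n : ℕ∞)} = (Finset.range n : Set ℕ) := by
      ext j
      simp only [Set.mem_ofPred_eq, Nat.cast_le, Finset.coe_range, Set.mem_Iio]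
      omega
    rw [this, Set.encard_coe_eq_coe_finsetCard, Finset.card_range]

theorem lt_ranked_iff {ι : Type*} (a : ι → ℝ≥0∞) (j : ℕ) (t : ℝ≥0∞) :
    t < ranked a j ↔ ((j + 1 : ℕ) : ℕ∞) ≤ countAbove a t :=
  lt_kthLargest_iff a j.succ_pos t

theorem countAbove_ranked {ι : Type*} (a : ι → ℝ≥0∞) (t : ℝ≥0∞) :
    countAbove (ranked a) t = countAbove a t := by
  rw [countAbove, ← encard_setOf_succ_le (countAbove a t)]
  simp only [lt_ranked_iff]

theorem antitone_ranked {ι : Type*} (a : ι → ℝ≥0∞) : Antitone (ranked a) := by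
  intro i j hij
  refine le_of_forall_lt fun t ht => ?_
  rw [lt_ranked_iff] at ht ⊢
  exact le_trans (by exact_mod_cast Nat.succ_le_succ hij) ht

theorem kthLargest_antitone {ι : Type*} (a : ι → ℝ≥0∞) : Antitone (kthLargest a) := by
  intro i j hij
  refine sInf_le_sInf fun t ht => ?_
  rw [Set.mem_ofPred_eq] at ht ⊢
  exact ht.trans_le (by exact_mod_cast hij)

theorem countAbove_sumElim {ι κ : Type*} (b : ι → ℝ≥0∞) (a : κ → ℝ≥0∞) (t : ℝ≥0∞) :
    countAbove (Sum.elim b a) t = countAbove b t + countAbove a t := by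
  have : {i | t < Sum.elim b a i} = Sum.inl '' {i | t < b i} ∪ Sum.inr '' {i | t < a i} := by
    ext (i | i) <;> simp
  rw [countAbove, this, Set.encard_union_eq, Sum.inl_injective.encard_image,
    Sum.inr_injective.encard_image, countAbove, countAbove]
  rw [Set.disjoint_left]
  rintro _ ⟨i, -, rfl⟩ ⟨j, -, h⟩
  exact Sum.inr_ne_inl h

theorem countAbove_merge {ι κ : Type*} (b : ι → ℝ≥0∞) (a : κ → ℝ≥0∞) (t : ℝ≥0∞) :
    countAbove (merge b a) t = countAbove b t + countAbove a t := by
  rw [merge, countAbove_ranked, countAbove_sumElim]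

theorem countAbove_comp_equiv {ι κ : Type*} (e : ι ≃ κ) (a : κ → ℝ≥0∞) (t : ℝ≥0∞) :
    countAbove (fun i => a (e i)) t = countAbove a t := by
  have : {i | t < a i} = e '' {i | t < a (e i)} := by
    ext i
    simp only [Set.mem_ofPred_eq, Set.mem_image]
    exact ⟨fun h => ⟨e.symm i, by simpa using h, by simp⟩, by rintro ⟨j, hj, rfl⟩; exact hj⟩
  rw [countAbove, countAbove, this, e.injective.encard_image]

theorem countAbove_const_mul {ι : Type*} {c : ℝ≥0∞} (hc : c ≠ 0) (hc' : c ≠ ∞) (a : ι → ℝ≥0∞)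
    (t : ℝ≥0∞) : countAbove (fun i => c * a i) t = countAbove a (t / c) := by
  have : ∀ x, t < c * x ↔ t / c < x := fun x => by
    rw [ENNReal.div_lt_iff (.inl hc) (.inl hc'), mul_comm]
  simp only [countAbove, this]

theorem countAbove_zero_mul {ι : Type*} (a : ι → ℝ≥0∞) (t : ℝ≥0∞) :
    countAbove (fun i => 0 * a i) t = 0 := by
  simp [countAbove]

/-- Scaling a ranked family agrees with scaling the family it was ranked from. -/
theorem countAbove_const_mul_congr {ι κ : Type*} {c : ℝ≥0∞} (hc' : c ≠ ∞) {a : ι → ℝ≥0∞}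
    {b : κ → ℝ≥0∞} (h : ∀ t, countAbove a t = countAbove b t) (t : ℝ≥0∞) :
    countAbove (fun i => c * a i) t = countAbove (fun i => c * b i) t := by
  rcases eq_or_ne c 0 with rfl | hc
  · rw [countAbove_zero_mul, countAbove_zero_mul]
  · rw [countAbove_const_mul hc hc', countAbove_const_mul hc hc', h]

theorem kthLargest_const_mul {ι : Type*} {c : ℝ≥0∞} (hc' : c ≠ ∞) (a : ι → ℝ≥0∞) {k : ℕ}
    (hk : 0 < k) : kthLargest (fun i => c * a i) k = c * kthLargest a k := by
  refine eq_of_forall_lt_iff fun t => ?_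
  rw [lt_kthLargest_iff _ hk]
  rcases eq_or_ne c 0 with rfl | hc
  · rw [countAbove_zero_mul, zero_mul]
    simp [hk.ne']
  · rw [countAbove_const_mul hc hc', ← lt_kthLargest_iff _ hk,
      ENNReal.div_lt_iff (.inl hc) (.inl hc'), mul_comm]

theorem ranked_const_mul {ι : Type*} {c : ℝ≥0∞} (hc' : c ≠ ∞) (a : ι → ℝ≥0∞) :
    ranked (fun i => c * a i) = fun j => c * ranked a j :=
  funext fun j => kthLargest_const_mul hc' a j.succ_pos

theorem const_mul_merge {ι κ : Type*} {c : ℝ≥0∞} (hc : c ≠ ∞) (b : ι → ℝ≥0∞) (a : κ → ℝ≥0∞) :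
    (fun j => c * merge b a j) = merge (fun i => c * b i) (fun i => c * a i) := by
  rw [merge, ← ranked_const_mul hc, merge]
  congr 1
  ext (i | i) <;> rfl

theorem splice_eq_merge (u : unitInterval) (b a : ℕ → ℝ≥0∞) :
    splice u b a = merge (fun i => ENNReal.ofReal u * b i)
      (fun i => ENNReal.ofReal (1 - u) * a i) := by
  rw [merge]
  rfl

theorem ranked_eq_zero_of_isEmpty {ι : Type*} [IsEmpty ι] (a : ι → ℝ≥0∞) : ranked a = 0 := by
  funext j
  have : ¬ 0 < ranked a j := by
    rw [lt_ranked_iff, countAbove]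
    simp [Set.eq_empty_of_isEmpty]
  simpa using this

theorem measurable_ranked {ι : Type*} [Countable ι] :
    Measurable (ranked : (ι → ℝ≥0∞) → ℕ → ℝ≥0∞) :=
  measurable_pi_lambda _ fun j => measurable_kthLargest (j + 1)

theorem measurable_merge {ι κ : Type*} [Countable ι] [Countable κ] :
    Measurable fun p : (ι → ℝ≥0∞) × (κ → ℝ≥0∞) => merge p.1 p.2 := by
  simp only [merge]
  refine measurable_ranked.comp (measurable_pi_lambda _ ?_)
  rintro (i | i)
  · exact (measurable_pi_apply i).comp measurable_fst
  · exact (measurable_pi_apply i).comp measurable_snd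

theorem kthLargest_eq_of_antitone {a : ℕ → ℝ≥0∞} (ha : Antitone a) {k : ℕ} (hk : 0 < k) :
    kthLargest a k = a (k - 1) := by
  refine eq_of_forall_lt_iff fun t => ?_
  rw [lt_kthLargest_iff a hk]
  constructor
  · intro h
    by_contra hlt
    have hsub : {i | t < a i} ⊆ (Finset.range (k - 1) : Set ℕ) := by
      intro i (hi : t < a i)
      by_contra hik
      rw [Finset.coe_range, Set.mem_Iio, not_lt] at hik
      exact hlt (hi.trans_le (ha hik))
    have h2 := h.trans (Set.encard_le_encard hsub)
    rw [Set.encard_coe_eq_coe_finsetCard, Finset.card_range] at h2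
    have : k ≤ k - 1 := by exact_mod_cast h2
    omega
  · intro h
    have hsub : (Finset.range k : Set ℕ) ⊆ {i | t < a i} := by
      intro i hi
      rw [Finset.coe_range, Set.mem_Iio] at hi
      exact h.trans_le (ha (by omega))
    have h2 := Set.encard_le_encard hsub
    rwa [Set.encard_coe_eq_coe_finsetCard, Finset.card_range] at h2

/-! ### Summable distance and ranking -/

theorem volume_layer (x y : ℝ≥0∞) :
    volume {t : ℝ | 0 ≤ t ∧ y ≤ ENNReal.ofReal t ∧ ENNReal.ofReal t < x} = x - y := by
  rcases eq_or_ne y ∞ with rfl | hy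
  · simp
  lift y to NNReal using hy
  induction x using ENNReal.recTopCoe with
  | top =>
    have : {t : ℝ | 0 ≤ t ∧ (y : ℝ≥0∞) ≤ ENNReal.ofReal t ∧ ENNReal.ofReal t < ∞}
        = Set.Ici (y : ℝ) := by
      ext t
      simp only [Set.mem_ofPred_eq, ENNReal.ofReal_lt_top, and_true, Set.mem_Ici]
      constructor
      · rintro ⟨h0, h⟩
        rw [← ENNReal.ofReal_coe_nnreal] at h
        exact (ENNReal.ofReal_le_ofReal_iff h0).mp h
      · intro h
        refine ⟨y.2.trans h, ?_⟩
        rw [← ENNReal.ofReal_coe_nnreal]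
        exact ENNReal.ofReal_le_ofReal h
    rw [this, Real.volume_Ici, ENNReal.top_sub_coe]
  | coe x =>
    have : {t : ℝ | 0 ≤ t ∧ (y : ℝ≥0∞) ≤ ENNReal.ofReal t ∧ ENNReal.ofReal t < (x : ℝ≥0∞)}
        = Set.Ico (y : ℝ) x := by
      ext t
      simp only [Set.mem_ofPred_eq, Set.mem_Ico]
      rw [← ENNReal.ofReal_coe_nnreal, ← ENNReal.ofReal_coe_nnreal]
      constructor
      · rintro ⟨h0, h, h'⟩
        exact ⟨(ENNReal.ofReal_le_ofReal_iff h0).mp h,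
          ((ENNReal.ofReal_lt_ofReal_iff_of_nonneg h0).mp h')⟩
      · rintro ⟨h, h'⟩
        have h0 : 0 ≤ t := y.2.trans h
        exact ⟨h0, ENNReal.ofReal_le_ofReal h,
          (ENNReal.ofReal_lt_ofReal_iff_of_nonneg h0).mpr h'⟩
    rw [this, Real.volume_Ico, ENNReal.ofReal_sub _ y.coe_nonneg, ENNReal.ofReal_coe_nnreal,
      ENNReal.ofReal_coe_nnreal]

/-- Layer-cake formula for the total excess of the family `x` over the family `y`. -/
theorem tsum_tsub_eq_lintegral {ι : Type*} [Countable ι] (x y : ι → ℝ≥0∞) :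
    ∑' i, (x i - y i) = ∫⁻ t in Set.Ici (0 : ℝ),
      ({i | y i ≤ ENNReal.ofReal t ∧ ENNReal.ofReal t < x i}.encard : ℝ≥0∞) := by
  have h : ∀ t : ℝ, ({i | y i ≤ ENNReal.ofReal t ∧ ENNReal.ofReal t < x i}.encard : ℝ≥0∞)
      = ∑' i, {t : ℝ | y i ≤ ENNReal.ofReal t ∧ ENNReal.ofReal t < x i}.indicator 1 t := by
    intro t
    rw [← ENNReal.tsum_set_one,
      tsum_subtype {i | y i ≤ ENNReal.ofReal t ∧ ENNReal.ofReal t < x i} fun _ => (1 : ℝ≥0∞)]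
    rfl
  have hm : ∀ i, MeasurableSet {t : ℝ | y i ≤ ENNReal.ofReal t ∧ ENNReal.ofReal t < x i} :=
    fun i => (measurableSet_le measurable_const ENNReal.measurable_ofReal).inter
      (measurableSet_lt ENNReal.measurable_ofReal measurable_const)
  simp only [h]
  rw [lintegral_tsum fun i => (measurable_one.indicator (hm i)).aemeasurable]
  refine tsum_congr fun i => ?_
  rw [lintegral_indicator_one (hm i), Measure.restrict_apply (hm i), ← volume_layer]
  congr 1
  ext t
  simp [and_comm]

/-- Ranking two families does not increase the total excess of one over the other. -/
theorem tsum_ranked_tsub_le {ι : Type*} [Countable ι] (x y : ι → ℝ≥0∞) :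
    ∑' i, (ranked x i - ranked y i) ≤ ∑' i, (x i - y i) := by
  rw [tsum_tsub_eq_lintegral, tsum_tsub_eq_lintegral]
  refine lintegral_mono fun t => ENat.toENNReal_le.mpr ?_
  set s := ENNReal.ofReal t
  have h1 : {i | ranked y i ≤ s ∧ s < ranked x i} = {i | s < ranked x i} \ {i | s < ranked y i} := by
    ext i
    simp [and_comm]
  have h2 : {i | y i ≤ s ∧ s < x i} = {i | s < x i} \ {i | s < y i} := by
    ext i
    simp [and_comm]
  rw [h1, h2]
  have h3 : countAbove x s ≤ countAbove y s + ({i | s < x i} \ {i | s < y i}).encard := by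
    refine le_trans (Set.encard_le_encard ?_) (Set.encard_union_le _ _)
    intro i hi
    by_cases h : s < y i
    · exact .inl h
    · exact .inr ⟨hi, h⟩
  rcases eq_or_ne (countAbove y s) ⊤ with htop | htop
  · have : {i | s < ranked x i} \ {i | s < ranked y i} = ∅ := by
      ext i
      simp [lt_ranked_iff, htop]
    rw [this]
    simp
  rcases le_total (countAbove x s) (countAbove y s) with hle | hle
  · have : {i | s < ranked x i} \ {i | s < ranked y i} = ∅ := by
      ext i
      simp only [lt_ranked_iff, Set.mem_sdiff, Set.mem_ofPred_eq, Set.mem_empty_iff_false, iff_false,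
        not_and, not_not]
      exact fun h => h.trans hle
    rw [this]
    simp
  · have hsub : {i | s < ranked y i} ⊆ {i | s < ranked x i} := by
      intro i
      simp only [lt_ranked_iff, Set.mem_ofPred_eq]
      exact fun h => h.trans hle
    have h4 := Set.encard_sdiff_add_encard_of_subset hsub
    change _ + countAbove (ranked y) s = countAbove (ranked x) s at h4
    rw [countAbove_ranked, countAbove_ranked] at h4
    rw [← h4, add_comm (countAbove y s)] at h3
    exact (ENat.add_le_add_iff_right htop).mp h3

theorem tsum_ranked {ι : Type*} [Countable ι] (x : ι → ℝ≥0∞) :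
    ∑' i, ranked x i = ∑' i, x i := by
  have h1 := tsum_tsub_eq_lintegral x 0
  have h2 := tsum_tsub_eq_lintegral (ranked x) 0
  simp only [Pi.zero_apply, tsub_zero, zero_le, true_and] at h1 h2
  rw [h1, h2]
  exact lintegral_congr fun t => congrArg _ (countAbove_ranked x _)

/-- The `ℓ¹` distance of two families of nonnegative numbers. -/
noncomputable def sumDist {ι : Type*} (x y : ι → ℝ≥0∞) : ℝ≥0∞ :=
  ∑' i, (x i - y i) + ∑' i, (y i - x i)

theorem sumDist_ranked_le {ι : Type*} [Countable ι] (x y : ι → ℝ≥0∞) :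
    sumDist (ranked x) (ranked y) ≤ sumDist x y :=
  add_le_add (tsum_ranked_tsub_le x y) (tsum_ranked_tsub_le y x)

theorem sumDist_merge_le {ι κ : Type*} [Countable ι] [Countable κ] (b b' : ι → ℝ≥0∞)
    (a a' : κ → ℝ≥0∞) : sumDist (merge b a) (merge b' a') ≤ sumDist b b' + sumDist a a' := by
  rw [merge, merge]
  refine (sumDist_ranked_le _ _).trans (le_of_eq ?_)
  simp only [sumDist]
  rw [ENNReal.summable.tsum_sum ENNReal.summable, ENNReal.summable.tsum_sum ENNReal.summable]
  simp only [Sum.elim_inl, Sum.elim_inr]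
  ring

theorem sumDist_self {ι : Type*} (x : ι → ℝ≥0∞) : sumDist x x = 0 := by
  simp [sumDist]

theorem sumDist_mul_right {ι : Type*} {c d : ℝ≥0∞} {x : ι → ℝ≥0∞} (hx : ∑' i, x i = 1) :
    sumDist (fun i => c * x i) (fun i => d * x i) = (c - d) + (d - c) := by
  have hx' : ∀ i, x i ≠ ∞ := fun i => ENNReal.ne_top_of_tsum_ne_top (by simp [hx]) i
  simp only [sumDist]
  rw [tsum_congr fun i => (ENNReal.sub_mul fun _ _ => hx' i).symm,
    tsum_congr fun i => (ENNReal.sub_mul (a := d) (b := c) fun _ _ => hx' i).symm,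
    ENNReal.tsum_mul_left, ENNReal.tsum_mul_left, hx, mul_one, mul_one]

theorem _root_.Measurable.merge {Ω ι κ : Type*} [MeasurableSpace Ω] [Countable ι] [Countable κ]
    {b : Ω → ι → ℝ≥0∞} {a : Ω → κ → ℝ≥0∞} (hb : Measurable b) (ha : Measurable a) :
    Measurable fun ω => merge (b ω) (a ω) := by
  have h := measurable_merge.comp (hb.prodMk ha)
  exact h

theorem measurable_merge_right {ι κ : Type*} [Countable ι] [Countable κ] (b : ι → ℝ≥0∞) :
    Measurable fun a : κ → ℝ≥0∞ => merge b a :=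
  measurable_const.merge measurable_id

/-! ### Test functions -/

/-- The class of test functions that drives the comparison of laws on sequences: bounded
measurable functions that are `1`-Lipschitz for the `ℓ¹` distance. -/
structure IsTest (F : (ℕ → ℝ≥0∞) → ℝ) : Prop where
  measurable : Measurable F
  bounded : ∃ C, ∀ x, |F x| ≤ C
  lipschitz : ∀ x y, ENNReal.ofReal |F x - F y| ≤ sumDist x y

theorem integrable_of_bounded {Ω : Type*} [MeasurableSpace Ω] {μ : Measure Ω} [IsFiniteMeasure μ]
    {f : Ω → ℝ} (hf : Measurable f) (hb : ∃ C, ∀ x, |f x| ≤ C) : Integrable f μ :=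
  let ⟨C, hC⟩ := hb
  Integrable.of_bound hf.aestronglyMeasurable C (.of_forall hC)

theorem abs_integral_le_of_bounded {Ω : Type*} [MeasurableSpace Ω] {μ : Measure Ω}
    [IsProbabilityMeasure μ] {f : Ω → ℝ} {C : ℝ} (h : ∀ᵐ x ∂μ, |f x| ≤ C) :
    |∫ x, f x ∂μ| ≤ C := by
  simpa using norm_integral_le_of_norm_le_const (μ := μ) (f := f) h

theorem abs_integral_sub_integral_le {Ω : Type*} [MeasurableSpace Ω] {μ : Measure Ω}
    [IsProbabilityMeasure μ] {f g : Ω → ℝ} (hf : Integrable f μ) (hg : Integrable g μ) {C : ℝ}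
    (h : ∀ᵐ x ∂μ, |f x - g x| ≤ C) : |∫ x, f x ∂μ - ∫ x, g x ∂μ| ≤ C := by
  rw [← integral_sub hf hg]
  exact abs_integral_le_of_bounded h

namespace IsTest

variable {F : (ℕ → ℝ≥0∞) → ℝ}

/-- Test functions are stable under merging the argument with a fixed family. -/
theorem comp_merge (hF : IsTest F) (b : ℕ → ℝ≥0∞) : IsTest fun z => F (merge b z) where
  measurable := hF.measurable.comp (measurable_merge_right b)
  bounded := hF.bounded.imp fun _ h _ => h _
  lipschitz x y := (hF.lipschitz _ _).trans <| (sumDist_merge_le _ _ _ _).trans_eq <| by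
    rw [sumDist_self, zero_add]

theorem abs_sub_le (hF : IsTest F) {x y : ℕ → ℝ≥0∞} {r : ℝ} (hr : 0 ≤ r)
    (h : sumDist x y ≤ ENNReal.ofReal r) : |F x - F y| ≤ r :=
  (ENNReal.ofReal_le_ofReal_iff hr).mp ((hF.lipschitz x y).trans h)

end IsTest

/-! ### Laws built by splitting off a cycle -/

/-- Laws `ν n` of sequences of total mass `n` such that the sequence of law `ν n` is obtained by
choosing `ℓ` uniformly in `{1, …, n}` and merging `ℓ` times a sequence of law `β` with an
independent sequence of law `ν (n - ℓ)`. -/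
structure IsSplitRecursion (β : Measure (ℕ → ℝ≥0∞)) (ν : ℕ → Measure (ℕ → ℝ≥0∞)) : Prop where
  zero : ν 0 = Measure.dirac 0
  succ : ∀ (N : ℕ) (F : (ℕ → ℝ≥0∞) → ℝ), Measurable F → (∃ C, ∀ x, |F x| ≤ C) →
    (N + 1 : ℝ) * ∫ x, F x ∂ν (N + 1) = ∑ j ∈ Finset.range (N + 1),
      ∫ b, ∫ y, F (merge (fun i => ((j + 1 : ℕ) : ℝ≥0∞) * b i) y) ∂ν (N - j) ∂β

theorem sum_harmonic (n : ℕ) :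
    ∑ j ∈ Finset.range n, (harmonic j : ℝ) = n * (harmonic n : ℝ) - n := by
  induction n with
  | zero => simp
  | succ n ih =>
    rw [Finset.sum_range_succ, ih, harmonic_succ]
    push_cast
    field_simp
    ring

theorem harmonic_nonneg (n : ℕ) : 0 ≤ (harmonic n : ℝ) := by
  exact_mod_cast Finset.sum_nonneg fun _ _ => by positivity

theorem tendsto_harmonic_div : Tendsto (fun n : ℕ => (harmonic n : ℝ) / n) atTop (𝓝 0) := by
  have h1 : Tendsto (fun n : ℕ => (1 + Real.log n) / (n : ℝ)) atTop (𝓝 0) := by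
    have h2 : Tendsto (fun x : ℝ => (1 + Real.log x) / x) atTop (𝓝 0) := by
      have h3 := (Real.isLittleO_log_id_atTop.tendsto_div_nhds_zero).add tendsto_inv_atTop_zero
      rw [add_zero] at h3
      refine h3.congr fun x => ?_
      simp only [id]
      ring
    exact h2.comp tendsto_natCast_atTop_atTop
  exact squeeze_zero (fun n => div_nonneg (harmonic_nonneg n) n.cast_nonneg)
    (fun n => div_le_div_of_nonneg_right (harmonic_le_one_add_log n) n.cast_nonneg) h1

/-- The integral form of `𝒜 = (U ℬ, (1 - U) 𝒜)`. -/
theorem IsSelfSimilarPartition.integral_eq {β : Measure (ℕ → ℝ≥0∞)} [IsProbabilityMeasure β]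
    {𝒜 : ProbabilityMeasure (ℕ → ℝ≥0∞)} (h : IsSelfSimilarPartition β 𝒜) {f : (ℕ → ℝ≥0∞) → ℝ}
    (hf : Measurable f) (hb : ∃ C, ∀ x, |f x| ≤ C) :
    ∫ a, f a ∂(𝒜 : Measure (ℕ → ℝ≥0∞)) = ∫ u in (0 : ℝ)..1, ∫ b, ∫ a,
      f (merge (fun i => ENNReal.ofReal u * b i) (fun i => ENNReal.ofReal (1 - u) * a i))
      ∂(𝒜 : Measure (ℕ → ℝ≥0∞)) ∂β := by
  have hm : Measurable fun p : unitInterval × (ℕ → ℝ≥0∞) × (ℕ → ℝ≥0∞) =>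
      f (splice p.1 p.2.1 p.2.2) := hf.comp measurable_splice
  have hb' : ∃ C, ∀ p : unitInterval × (ℕ → ℝ≥0∞) × (ℕ → ℝ≥0∞),
      |f (splice p.1 p.2.1 p.2.2)| ≤ C := hb.imp fun _ h p => h (splice p.1 p.2.1 p.2.2)
  have h1 : ∫ a, f a ∂(𝒜 : Measure (ℕ → ℝ≥0∞)) = ∫ u : unitInterval, ∫ p, f (splice u p.1 p.2)
      ∂(β.prod (𝒜 : Measure (ℕ → ℝ≥0∞))) := by
    conv_lhs => rw [h.2]
    rw [integral_map measurable_splice.aemeasurable hf.aestronglyMeasurable]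
    exact integral_prod _ (integrable_of_bounded hm hb')
  have h2 : ∀ u : unitInterval, ∫ p, f (splice u p.1 p.2) ∂(β.prod (𝒜 : Measure (ℕ → ℝ≥0∞)))
      = ∫ b, ∫ a, f (splice u b a) ∂(𝒜 : Measure (ℕ → ℝ≥0∞)) ∂β := by
    intro u
    have hpair : Measurable fun p : (ℕ → ℝ≥0∞) × (ℕ → ℝ≥0∞) => (u, p) := measurable_prodMk_left
    have hu := hm.comp hpair
    exact integral_prod (fun p : (ℕ → ℝ≥0∞) × (ℕ → ℝ≥0∞) => f (splice u p.1 p.2))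
      (integrable_of_bounded hu (hb.imp fun _ h p => h (splice u p.1 p.2)))
  rw [h1, integral_congr_ae (.of_forall h2)]
  simp only [splice_eq_merge]
  rw [intervalIntegral.integral_of_le zero_le_one, ← integral_Icc_eq_integral_Ioc,
    ← integral_subtype_comap measurableSet_Icc]
  rfl

theorem measurable_merge_smul {f : (ℕ → ℝ≥0∞) → ℝ} (hf : Measurable f) {g h : ℝ → ℝ≥0∞}
    (hg : Measurable g) (hh : Measurable h) :
    Measurable fun p : (ℝ × (ℕ → ℝ≥0∞)) × (ℕ → ℝ≥0∞) =>
      f (merge (fun i => g p.1.1 * p.1.2 i) (fun i => h p.1.1 * p.2 i)) := by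
  have h1 : Measurable fun p : (ℝ × (ℕ → ℝ≥0∞)) × (ℕ → ℝ≥0∞) => fun i => g p.1.1 * p.1.2 i :=
    measurable_pi_lambda _ fun i => by fun_prop
  have h2 : Measurable fun p : (ℝ × (ℕ → ℝ≥0∞)) × (ℕ → ℝ≥0∞) => fun i => h p.1.1 * p.2 i :=
    measurable_pi_lambda _ fun i => by fun_prop
  exact hf.comp (h1.merge h2)

theorem ofReal_tsub_add_tsub {x y : ℝ} (hx : 0 ≤ x) (hy : 0 ≤ y) (h : |x - y| ≤ 1) :
    (ENNReal.ofReal x - ENNReal.ofReal y) + (ENNReal.ofReal y - ENNReal.ofReal x) ≤ 1 := by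
  rw [← ENNReal.ofReal_sub _ hy, ← ENNReal.ofReal_sub _ hx]
  rw [abs_le] at h
  rcases le_total x y with hxy | hxy
  · rw [ENNReal.ofReal_of_nonpos (by linarith : x - y ≤ 0), zero_add]
    exact ENNReal.ofReal_le_one.mpr (by linarith)
  · rw [ENNReal.ofReal_of_nonpos (by linarith : y - x ≤ 0), add_zero]
    exact ENNReal.ofReal_le_one.mpr (by linarith)

/-- Replacing the continuous splitting point `u ∈ [j / (N + 1), (j + 1) / (N + 1)]` by the discrete
one moves the merged sequence of total mass `N + 1` by at most `2`. -/
theorem IsTest.abs_discretize_le {F : (ℕ → ℝ≥0∞) → ℝ} (hF : IsTest F) {a b : ℕ → ℝ≥0∞}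
    (ha : ∑' i, a i = 1) (hb : ∑' i, b i = 1) {N j : ℕ} (hj : j ≤ N) {u : ℝ}
    (hu : (j : ℝ) / (N + 1 : ℕ) ≤ u) (hu' : u ≤ (j + 1 : ℕ) / (N + 1 : ℕ)) :
    |F (merge (fun i => ENNReal.ofReal ((N + 1 : ℕ) * u) * b i)
        (fun i => ENNReal.ofReal ((N + 1 : ℕ) * (1 - u)) * a i)) -
      F (merge (fun i => ((j + 1 : ℕ) : ℝ≥0∞) * b i) (fun i => ((N - j : ℕ) : ℝ≥0∞) * a i))|
      ≤ 2 := by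
  have hN : (0 : ℝ) < (N + 1 : ℕ) := by positivity
  rw [div_le_iff₀ hN] at hu
  rw [le_div_iff₀ hN] at hu'
  have hj' : (j : ℝ) ≤ N := by exact_mod_cast hj
  have hj0 : (0 : ℝ) ≤ j := j.cast_nonneg
  refine hF.abs_sub_le two_pos.le ((sumDist_merge_le _ _ _ _).trans ?_)
  rw [sumDist_mul_right ha, sumDist_mul_right hb, ← ENNReal.ofReal_natCast (j + 1),
    ← ENNReal.ofReal_natCast (N - j)]
  have h2 : ENNReal.ofReal 2 = 1 + 1 := by norm_num
  rw [h2]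
  push_cast [hj] at hu hu' ⊢
  refine add_le_add (ofReal_tsub_add_tsub ?_ ?_ ?_) (ofReal_tsub_add_tsub ?_ ?_ ?_)
  · nlinarith
  · positivity
  · rw [abs_le]
    constructor <;> nlinarith
  · nlinarith
  · linarith
  · rw [abs_le]
    constructor <;> nlinarith

/-- A self-similar partition scaled by `n` and a sequence obtained by splitting off cycles from
total mass `n` are at distance at most `2 (1 + 1 / 2 + ⋯ + 1 / n)`, as seen by test functions. -/
theorem IsSplitRecursion.abs_integral_sub_le {β : Measure (ℕ → ℝ≥0∞)} [IsProbabilityMeasure β]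
    (hβ : ∀ᵐ b ∂β, ∑' i, b i = 1) {𝒜 : ProbabilityMeasure (ℕ → ℝ≥0∞)}
    (hA : IsSelfSimilarPartition β 𝒜) {ν : ℕ → Measure (ℕ → ℝ≥0∞)}
    [∀ n, IsProbabilityMeasure (ν n)] (hν : IsSplitRecursion β ν) (n : ℕ) :
    ∀ F : (ℕ → ℝ≥0∞) → ℝ, IsTest F →
      |∫ a, F (fun i => (n : ℝ≥0∞) * a i) ∂(𝒜 : Measure (ℕ → ℝ≥0∞)) - ∫ y, F y ∂ν n|
        ≤ 2 * (harmonic n : ℝ) := by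
  induction n using Nat.strong_induction_on with
  | _ n ih =>
  intro F hF
  rcases n with _ | N
  · rw [hν.zero]
    have h0 : (fun _ : ℕ => (0 : ℝ≥0∞)) = 0 := rfl
    simp [h0]
  set f : (ℕ → ℝ≥0∞) → ℝ := fun a => F (fun i => ((N + 1 : ℕ) : ℝ≥0∞) * a i) with hf_def
  have hfm : Measurable f := hF.measurable.comp (by fun_prop)
  have hfb : ∃ C, ∀ x, |f x| ≤ C := hF.bounded.imp fun _ h _ => h _
  set G : ℝ → ℝ := fun u => ∫ b, ∫ a,
      f (merge (fun i => ENNReal.ofReal u * b i) (fun i => ENNReal.ofReal (1 - u) * a i))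
      ∂(𝒜 : Measure (ℕ → ℝ≥0∞)) ∂β with hG
  set c : ℕ → ℝ := fun j =>
    ∫ b, ∫ y, F (merge (fun i => ((j + 1 : ℕ) : ℝ≥0∞) * b i) y) ∂ν (N - j) ∂β with hc
  have hN : (0 : ℝ) < (N + 1 : ℕ) := by positivity
  have hmeas : Measurable fun p : (ℝ × (ℕ → ℝ≥0∞)) × (ℕ → ℝ≥0∞) =>
      f (merge (fun i => ENNReal.ofReal p.1.1 * p.1.2 i)
        (fun i => ENNReal.ofReal (1 - p.1.1) * p.2 i)) :=
    measurable_merge_smul (g := fun u => ENNReal.ofReal u) (h := fun u => ENNReal.ofReal (1 - u))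
      hfm (by fun_prop) (by fun_prop)
  have hmeas1 := hmeas.stronglyMeasurable.integral_prod_right' (ν := (𝒜 : Measure (ℕ → ℝ≥0∞)))
  have hGm : StronglyMeasurable G := hmeas1.integral_prod_right' (ν := β)
  obtain ⟨C, hC⟩ := hfb
  have hGb : ∃ C, ∀ u, |G u| ≤ C := ⟨C, fun u => abs_integral_le_of_bounded (.of_forall fun b =>
    abs_integral_le_of_bounded (.of_forall fun a => hC _))⟩
  have hGi : ∀ x y : ℝ, IntervalIntegrable G volume x y := fun x y =>
    ⟨integrable_of_bounded hGm.measurable hGb, integrable_of_bounded hGm.measurable hGb⟩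
  -- on each of the `N + 1` intervals of equal length the integrand is almost constant
  have hbound : ∀ j ≤ N, ∀ u ∈ Set.uIoc ((j : ℝ) / (N + 1 : ℕ)) ((j + 1 : ℕ) / (N + 1 : ℕ)),
      ‖G u - c j‖ ≤ 2 + 2 * (harmonic (N - j) : ℝ) := by
    intro j hj u hu
    rw [Set.uIoc_of_le (by gcongr; simp)] at hu
    have hu0 : 0 ≤ u := le_trans (by positivity) hu.1.le
    have hu1 : 0 ≤ 1 - u := by
      have : (((j + 1 : ℕ) : ℝ)) / (N + 1 : ℕ) ≤ 1 := by
        rw [div_le_one hN]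
        exact_mod_cast Nat.succ_le_succ hj
      linarith [hu.2]
    have hmb : Measurable fun p : (ℕ → ℝ≥0∞) × (ℕ → ℝ≥0∞) =>
        F (merge (fun i => ((j + 1 : ℕ) : ℝ≥0∞) * p.1 i) p.2) := by
      have h1 : Measurable fun p : (ℕ → ℝ≥0∞) × (ℕ → ℝ≥0∞) =>
          fun i => ((j + 1 : ℕ) : ℝ≥0∞) * p.1 i := measurable_pi_lambda _ fun i => by fun_prop
      exact hF.measurable.comp (h1.merge measurable_snd)
    obtain ⟨C', hC'⟩ := hF.bounded
    refine abs_integral_sub_integral_le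
      (integrable_of_bounded (hmeas1.measurable.comp measurable_prodMk_left)
        ⟨C, fun b => abs_integral_le_of_bounded (.of_forall fun a => hC _)⟩)
      (integrable_of_bounded (hmb.stronglyMeasurable.integral_prod_right'
        (ν := ν (N - j))).measurable
        ⟨C', fun b => abs_integral_le_of_bounded (.of_forall fun a => hC' _)⟩) ?_
    filter_upwards [hβ] with b hb
    have hF' := hF.comp_merge (fun i => ((j + 1 : ℕ) : ℝ≥0∞) * b i)
    have h2 := ih (N - j) (by omega) _ hF'
    have h1 : |(∫ a, f (merge (fun i => ENNReal.ofReal u * b i)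
          (fun i => ENNReal.ofReal (1 - u) * a i)) ∂(𝒜 : Measure (ℕ → ℝ≥0∞))) -
        ∫ a, F (merge (fun i => ((j + 1 : ℕ) : ℝ≥0∞) * b i)
          (fun i => ((N - j : ℕ) : ℝ≥0∞) * a i)) ∂(𝒜 : Measure (ℕ → ℝ≥0∞))| ≤ 2 := by
      have hmu : Measurable fun a : ℕ → ℝ≥0∞ => f (merge (fun i => ENNReal.ofReal u * b i)
          (fun i => ENNReal.ofReal (1 - u) * a i)) :=
        hmeas.comp (measurable_prodMk_left (x := (u, b)))
      refine abs_integral_sub_integral_le (integrable_of_bounded hmu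
        ⟨C, fun _ => hC _⟩) (integrable_of_bounded (hF'.measurable.comp
          (by fun_prop : Measurable fun (a : ℕ → ℝ≥0∞) i => ((N - j : ℕ) : ℝ≥0∞) * a i))
        ⟨C', fun _ => hC' _⟩) ?_
      filter_upwards [hA.1] with a ha
      have hd := hF.abs_discretize_le ha.2 hb hj hu.1.le hu.2
      simp only [hf_def]
      rw [const_mul_merge (ENNReal.natCast_ne_top _)]
      simp only [← mul_assoc]
      rw [← ENNReal.ofReal_natCast (N + 1), ← ENNReal.ofReal_mul hN.le,
        ← ENNReal.ofReal_mul hN.le]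
      exact hd
    exact (abs_sub_le _ _ _).trans (add_le_add h1 h2)
  have hlen : ∀ j : ℕ, ((j + 1 : ℕ) : ℝ) / (N + 1 : ℕ) - (j : ℝ) / (N + 1 : ℕ)
      = 1 / (N + 1 : ℕ) := by
    intro j
    push_cast
    ring
  have hpiece : ∀ j ∈ Finset.range (N + 1),
      |(∫ u in ((j : ℝ) / (N + 1 : ℕ))..((j + 1 : ℕ) / (N + 1 : ℕ)), G u) - c j / (N + 1 : ℕ)|
        ≤ (2 + 2 * (harmonic (N - j) : ℝ)) / (N + 1 : ℕ) := by
    intro j hj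
    have hj' : j ≤ N := Nat.lt_succ_iff.mp (Finset.mem_range.mp hj)
    have h := intervalIntegral.norm_integral_le_of_norm_le_const (hbound j hj')
    rw [intervalIntegral.integral_sub (hGi _ _) (by simp), intervalIntegral.integral_const, hlen,
      abs_of_nonneg (by positivity), Real.norm_eq_abs, smul_eq_mul] at h
    rw [show c j / (N + 1 : ℕ) = 1 / (N + 1 : ℕ) * c j by ring]
    exact h.trans_eq (by ring)
  have hGsum : ∫ a, f a ∂(𝒜 : Measure (ℕ → ℝ≥0∞)) = ∑ j ∈ Finset.range (N + 1),
      ∫ u in ((j : ℝ) / (N + 1 : ℕ))..((j + 1 : ℕ) / (N + 1 : ℕ)), G u := by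
    rw [intervalIntegral.sum_integral_adjacent_intervals
      (a := fun j : ℕ => (j : ℝ) / (N + 1 : ℕ)) (fun j _ => hGi _ _), div_self hN.ne',
      Nat.cast_zero, zero_div]
    exact hA.integral_eq hfm ⟨C, hC⟩
  have hcsum : ∫ y, F y ∂ν (N + 1) = ∑ j ∈ Finset.range (N + 1), c j / (N + 1 : ℕ) := by
    rw [← Finset.sum_div, eq_div_iff hN.ne', mul_comm, hc]
    push_cast
    exact_mod_cast hν.succ N F hF.measurable hF.bounded
  have hrefl := Finset.sum_range_reflect (fun j => (harmonic j : ℝ)) (N + 1)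
  simp only [Nat.add_sub_cancel] at hrefl
  rw [hGsum, hcsum, ← Finset.sum_sub_distrib]
  refine (Finset.abs_sum_le_sum_abs _ _).trans ((Finset.sum_le_sum hpiece).trans_eq ?_)
  rw [← Finset.sum_div, Finset.sum_add_distrib, ← Finset.mul_sum,
    hrefl, sum_harmonic]
  simp
  field_simp
  ring

/-! ### Consequences of the comparison: convergence and uniqueness -/

theorem edist_toReal_le (x y : ℝ≥0∞) : edist x.toReal y.toReal ≤ (x - y) + (y - x) := by
  induction x using ENNReal.recTopCoe with
  | top =>
    induction y using ENNReal.recTopCoe with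
    | top => simp
    | coe y => simp
  | coe x =>
    induction y using ENNReal.recTopCoe with
    | top => simp
    | coe y =>
      rw [ENNReal.coe_toReal, ENNReal.coe_toReal, edist_dist, Real.dist_eq,
        ← ENNReal.coe_sub, ← ENNReal.coe_sub, ← ENNReal.coe_add]
      refine ENNReal.ofReal_le_of_le_toReal ?_
      rw [ENNReal.coe_toReal, NNReal.coe_add]
      rcases le_total x y with h | h
      · rw [tsub_eq_zero_of_le h, NNReal.coe_sub h, abs_sub_comm, abs_of_nonneg]
        · simp
        · simpa using h
      · rw [tsub_eq_zero_of_le h, NNReal.coe_sub h, abs_of_nonneg]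
        · simp
        · simpa using h

theorem edist_toReal_le_sumDist {ι : Type*} (x y : ι → ℝ≥0∞) (i : ι) :
    edist (x i).toReal (y i).toReal ≤ sumDist x y :=
  (edist_toReal_le _ _).trans (add_le_add (ENNReal.le_tsum (f := fun i => x i - y i) i)
    (ENNReal.le_tsum (f := fun i => y i - x i) i))

theorem sumDist_const_mul_le {ι : Type*} {c : ℝ≥0∞} (hc : c ≠ ∞) (x y : ι → ℝ≥0∞) :
    sumDist (fun i => c * x i) (fun i => c * y i) ≤ c * sumDist x y := by
  simp only [sumDist]
  rw [mul_add, ← ENNReal.tsum_mul_left, ← ENNReal.tsum_mul_left]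
  simp only [ENNReal.mul_sub fun _ _ => hc, le_refl]

/-- Bounded Lipschitz functions of finitely many terms are, up to a factor, test functions. -/
theorem isTest_of_lipschitzWith {I : Finset ℕ} {f : (I → ℝ) → ℝ} {L : NNReal}
    (hf : LipschitzWith L f) (hb : ∃ C, ∀ x y, dist (f x) (f y) ≤ C) :
    IsTest fun a => f (fun i => (a i).toReal) / (L + 1 : NNReal) where
  measurable := (hf.continuous.measurable.comp
    (measurable_pi_lambda _ fun i => (measurable_pi_apply (i : ℕ)).ennreal_toReal)).div_const _
  bounded := by
    obtain ⟨C, hC⟩ := hb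
    refine ⟨|f 0| + C, fun x => ?_⟩
    set y : I → ℝ := fun i => (x i).toReal
    have h1 : |f y| ≤ |f 0| + C := by
      have := hC y 0
      rw [Real.dist_eq] at this
      have h2 := abs_sub_abs_le_abs_sub (f y) (f 0)
      linarith
    rw [abs_div]
    refine (div_le_self (abs_nonneg _) ?_).trans h1
    rw [NNReal.abs_eq]
    exact_mod_cast le_add_of_nonneg_left L.2
  lipschitz x y := by
    have hL : (0 : ℝ) < (L + 1 : NNReal) := by positivity
    rw [← sub_div, abs_div, NNReal.abs_eq, ENNReal.ofReal_div_of_pos hL, ← Real.dist_eq,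
      ← edist_dist, ENNReal.ofReal_coe_nnreal]
    refine ENNReal.div_le_of_le_mul ?_
    refine (hf.edist_le_mul _ _).trans ?_
    rw [mul_comm]
    refine mul_le_mul' ?_ (by simp)
    rw [edist_pi_le_iff]
    exact fun i => edist_toReal_le_sumDist x y i

theorem IsSelfSimilarPartition.ae_ne_top {β : Measure (ℕ → ℝ≥0∞)}
    {𝒜 : ProbabilityMeasure (ℕ → ℝ≥0∞)} (hA : IsSelfSimilarPartition β 𝒜) :
    ∀ᵐ a ∂(𝒜 : Measure (ℕ → ℝ≥0∞)), ∀ i, a i ≠ ∞ := by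
  filter_upwards [hA.1] with a ha
  exact fun i => ENNReal.ne_top_of_tsum_ne_top (by simp [ha.2]) i

section

variable {β : Measure (ℕ → ℝ≥0∞)} [IsProbabilityMeasure β]
  {𝒜 : ProbabilityMeasure (ℕ → ℝ≥0∞)} {ν : ℕ → Measure (ℕ → ℝ≥0∞)}
  [∀ n, IsProbabilityMeasure (ν n)]

theorem IsSplitRecursion.tendsto_integral_of_isTest (hβ : ∀ᵐ b ∂β, ∑' i, b i = 1)
    (hA : IsSelfSimilarPartition β 𝒜) (hν : IsSplitRecursion β ν)
    {f : (ℕ → ℝ≥0∞) → ℝ} (hf : IsTest f) :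
    Tendsto (fun n : ℕ => ∫ y, f (fun i => (n : ℝ≥0∞)⁻¹ * y i) ∂ν n) atTop
      (𝓝 (∫ a, f a ∂(𝒜 : Measure (ℕ → ℝ≥0∞)))) := by
  rw [tendsto_iff_dist_tendsto_zero]
  have hlim := tendsto_harmonic_div.const_mul 2
  rw [mul_zero] at hlim
  refine squeeze_zero' (.of_forall fun _ => dist_nonneg) ?_ hlim
  filter_upwards [eventually_gt_atTop 0] with n hn
  have hn0 : (n : ℝ≥0∞) ≠ 0 := by exact_mod_cast hn.ne'
  have hnt : (n : ℝ≥0∞) ≠ ∞ := ENNReal.natCast_ne_top n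
  have hn' : (0 : ℝ) < n := by exact_mod_cast hn
  -- undo the scaling by `n`: the function `y ↦ n f (y / n)` is again a test function
  have hF : IsTest fun y => (n : ℝ) * f (fun i => (n : ℝ≥0∞)⁻¹ * y i) := by
    refine ⟨(hf.measurable.comp (by fun_prop)).const_mul _, ?_, fun x y => ?_⟩
    · obtain ⟨C, hC⟩ := hf.bounded
      refine ⟨n * C, fun x => ?_⟩
      rw [abs_mul, Nat.abs_cast]
      exact mul_le_mul_of_nonneg_left (hC _) hn'.le
    · rw [← mul_sub, abs_mul, Nat.abs_cast, ENNReal.ofReal_mul hn'.le, ENNReal.ofReal_natCast]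
      refine (mul_le_mul_right ((hf.lipschitz _ _).trans
        (sumDist_const_mul_le (ENNReal.inv_ne_top.mpr hn0) x y)) _).trans_eq ?_
      rw [← mul_assoc, ENNReal.mul_inv_cancel hn0 hnt, one_mul]
  have h := hν.abs_integral_sub_le hβ hA n _ hF
  simp only [← mul_assoc, ENNReal.inv_mul_cancel hn0 hnt, one_mul] at h
  rw [integral_const_mul, integral_const_mul, ← mul_sub, abs_mul, Nat.abs_cast] at h
  rw [dist_comm, Real.dist_eq, ← mul_div_assoc, le_div_iff₀ hn', mul_comm]
  exact h

/-- Laws of sequences of real numbers are determined by bounded Lipschitz functions of finitely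
many terms. -/
theorem eq_of_forall_integral_eq_of_isTest {𝒜 𝒜' : ProbabilityMeasure (ℕ → ℝ≥0∞)}
    (hA : ∀ᵐ a ∂(𝒜 : Measure (ℕ → ℝ≥0∞)), ∀ i, a i ≠ ∞)
    (hA' : ∀ᵐ a ∂(𝒜' : Measure (ℕ → ℝ≥0∞)), ∀ i, a i ≠ ∞)
    (h : ∀ f, IsTest f → ∫ a, f a ∂(𝒜 : Measure (ℕ → ℝ≥0∞))
      = ∫ a, f a ∂(𝒜' : Measure (ℕ → ℝ≥0∞))) : 𝒜 = 𝒜' := by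
  set T : (ℕ → ℝ≥0∞) → ℕ → ℝ := fun a i => (a i).toReal
  have hT : Measurable T :=
    measurable_pi_lambda _ fun i => (measurable_pi_apply i).ennreal_toReal
  have hinv : ∀ 𝒞 : ProbabilityMeasure (ℕ → ℝ≥0∞),
      (∀ᵐ a ∂(𝒞 : Measure (ℕ → ℝ≥0∞)), ∀ i, a i ≠ ∞) → (𝒞 : Measure (ℕ → ℝ≥0∞)) =
        ((𝒞 : Measure (ℕ → ℝ≥0∞)).map T).map fun x i => ENNReal.ofReal (x i) := by
    intro 𝒞 h𝒞
    rw [Measure.map_map (by fun_prop) hT]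
    conv_lhs => rw [← Measure.map_id (μ := (𝒞 : Measure (ℕ → ℝ≥0∞)))]
    refine Measure.map_congr ?_
    filter_upwards [h𝒞] with a ha
    funext i
    exact (ENNReal.ofReal_toReal (ha i)).symm
  have hfin : ∀ I : Finset ℕ, ((𝒜 : Measure (ℕ → ℝ≥0∞)).map T).map I.restrict =
      ((𝒜' : Measure (ℕ → ℝ≥0∞)).map T).map I.restrict := by
    intro I
    have hI : Measurable fun a : ℕ → ℝ≥0∞ => I.restrict (T a) := by fun_prop
    have hmap : 𝒜.map hI.aemeasurable = 𝒜'.map hI.aemeasurable := by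
      refine tendsto_nhds_unique (f := fun _ : ℕ => 𝒜.map hI.aemeasurable) (l := atTop)
        tendsto_const_nhds (tendsto_iff_forall_lipschitz_integral_tendsto.mpr ?_)
      rintro f hb ⟨L, hL⟩
      refine tendsto_const_nhds.congr fun _ => ?_
      rw [ProbabilityMeasure.toMeasure_map, ProbabilityMeasure.toMeasure_map,
        integral_map hI.aemeasurable hL.continuous.aestronglyMeasurable,
        integral_map hI.aemeasurable hL.continuous.aestronglyMeasurable]
      have h1 := h _ (isTest_of_lipschitzWith hL hb)
      rw [integral_div, integral_div, div_left_inj' (by positivity)] at h1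
      exact h1.symm
    have h2 := congrArg (fun μ : ProbabilityMeasure (I → ℝ) => (μ : Measure (I → ℝ))) hmap
    rw [Measure.map_map (by fun_prop) hT, Measure.map_map (by fun_prop) hT]
    exact h2
  have hTeq : (𝒜 : Measure (ℕ → ℝ≥0∞)).map T = (𝒜' : Measure (ℕ → ℝ≥0∞)).map T := by
    have : IsProbabilityMeasure ((𝒜' : Measure (ℕ → ℝ≥0∞)).map T) :=
      Measure.isProbabilityMeasure_map hT.aemeasurable
    exact IsProjectiveLimit.unique (P := fun I => ((𝒜' : Measure (ℕ → ℝ≥0∞)).map T).map I.restrict)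
      hfin (fun _ => rfl)
  apply Subtype.ext
  change (𝒜 : Measure (ℕ → ℝ≥0∞)) = 𝒜'
  rw [hinv 𝒜 hA, hinv 𝒜' hA', hTeq]

/-- Any two self-similar laws are limits of the same rescaled laws, hence equal. -/
theorem IsSplitRecursion.isSelfSimilarPartition_unique (hβ : ∀ᵐ b ∂β, ∑' i, b i = 1)
    (hν : IsSplitRecursion β ν) {𝒜' : ProbabilityMeasure (ℕ → ℝ≥0∞)}
    (hA : IsSelfSimilarPartition β 𝒜) (hA' : IsSelfSimilarPartition β 𝒜') : 𝒜 = 𝒜' :=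
  eq_of_forall_integral_eq_of_isTest hA.ae_ne_top hA'.ae_ne_top fun _ hf =>
    tendsto_nhds_unique (hν.tendsto_integral_of_isTest hβ hA hf)
      (hν.tendsto_integral_of_isTest hβ hA' hf)

theorem IsSplitRecursion.tendsto_integral_term (hβ : ∀ᵐ b ∂β, ∑' i, b i = 1)
    (hA : IsSelfSimilarPartition β 𝒜) (hν : IsSplitRecursion β ν) (j : ℕ) {g : ℝ → ℝ}
    {L : NNReal} (hg : LipschitzWith L g) (hb : ∃ C, ∀ x y, dist (g x) (g y) ≤ C) :
    Tendsto (fun n : ℕ => ∫ y, g ((y j).toReal / n) ∂ν n) atTop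
      (𝓝 (∫ a, g (a j).toReal ∂(𝒜 : Measure (ℕ → ℝ≥0∞)))) := by
  set i₀ : ({j} : Finset ℕ) := ⟨j, Finset.mem_singleton_self j⟩
  have hg' : LipschitzWith L fun x : ({j} : Finset ℕ) → ℝ => g (x i₀) := by
    have h := hg.comp (LipschitzWith.eval (α := fun _ : ({j} : Finset ℕ) => ℝ) i₀)
    rw [mul_one] at h
    exact h
  have h := hν.tendsto_integral_of_isTest hβ hA
    (isTest_of_lipschitzWith hg' (hb.imp fun _ h _ _ => h _ _))
  have hL : ((L + 1 : NNReal) : ℝ) ≠ 0 := by positivity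
  have h2 := h.mul_const ((L + 1 : NNReal) : ℝ)
  simp only [integral_div, div_mul_cancel₀ _ hL] at h2
  refine h2.congr fun n => integral_congr_ae (.of_forall fun y => ?_)
  simp [i₀, ENNReal.toReal_mul, ENNReal.toReal_inv, div_eq_inv_mul]

end

/-! ### Existence: stick breaking -/

/-- Prepending a term to a sequence. -/
def prepend {X : Type*} (p : X × (ℕ → X)) : ℕ → X
  | 0 => p.1
  | n + 1 => p.2 n

theorem measurable_prepend {X : Type*} [MeasurableSpace X] :
    Measurable (prepend : X × (ℕ → X) → ℕ → X) := by
  refine measurable_pi_lambda _ fun n => ?_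
  rcases n with _ | n
  · exact measurable_fst
  · exact (measurable_pi_apply n).comp measurable_snd

/-- A sequence of independent variables of law `μ` is one such variable followed by an independent
sequence of the same kind. -/
theorem map_prepend_infinitePi {X : Type*} [MeasurableSpace X] (μ : Measure X)
    [IsProbabilityMeasure μ] :
    (μ.prod (Measure.infinitePi fun _ : ℕ => μ)).map prepend = Measure.infinitePi fun _ => μ := by
  refine Measure.eq_infinitePi _ fun s t ht => ?_
  set t' : ℕ → Set X := fun i => if i ∈ s then t i else Set.univ with ht'_def
  have ht' : ∀ i, MeasurableSet (t' i) := fun i => by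
    simp only [ht'_def]
    split_ifs
    exacts [ht i, MeasurableSet.univ]
  obtain ⟨n, hn⟩ := s.exists_nat_subset_range
  have hn' : s ⊆ Finset.range (n + 1) := hn.trans (Finset.range_mono n.le_succ)
  have h1 : prepend ⁻¹' Set.pi (s : Set ℕ) t
      = t' 0 ×ˢ Set.pi (Finset.range n : Set ℕ) fun i => t' (i + 1) := by
    ext ⟨x, ω⟩
    simp only [Set.mem_preimage, Set.mem_pi, Finset.mem_coe, Set.mem_prod, Finset.mem_range,
      ht'_def]
    constructor
    · intro h
      refine ⟨?_, fun i _ => ?_⟩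
      · split_ifs with h0
        exacts [h 0 h0, trivial]
      · split_ifs with h0
        exacts [h (i + 1) h0, trivial]
    · rintro ⟨h0, h⟩ i hi
      rcases i with _ | i
      · rw [if_pos hi] at h0
        exact h0
      · have h2 := h i (by have := Finset.mem_range.mp (hn' hi); omega)
        rw [if_pos hi] at h2
        exact h2
  have hpi : MeasurableSet (Set.pi (s : Set ℕ) t) :=
    MeasurableSet.pi s.countable_toSet fun i _ => ht i
  rw [Measure.map_apply measurable_prepend hpi, h1, Measure.prod_prod,
    Measure.infinitePi_pi _ fun i _ => ht' (i + 1), mul_comm,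
    ← Finset.prod_range_succ' (fun i => μ (t' i)) n]
  symm
  rw [← Finset.prod_subset hn' (f := fun i => μ (t' i))]
  · exact Finset.prod_congr rfl fun i hi => by simp only [ht'_def, if_pos hi]
  · intro i _ hi
    simp only [ht'_def, if_neg hi, measure_univ]

/-- The pieces of the stick-breaking construction: the `i`-th step takes the fraction `U i` of what
is left after the steps before it, and divides it in the proportions `B i`. -/
noncomputable def stick (ω : ℕ → unitInterval × (ℕ → ℝ≥0∞)) (p : ℕ × ℕ) : ℝ≥0∞ :=
  (∏ k ∈ Finset.range p.1, ENNReal.ofReal (1 - (ω k).1)) *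
    (ENNReal.ofReal (ω p.1).1 * (ω p.1).2 p.2)

theorem measurable_stick : Measurable stick := by
  refine measurable_pi_lambda _ fun p => ?_
  refine Measurable.mul (Finset.measurable_fun_prod _ fun k _ => ?_) (Measurable.mul ?_ ?_)
  · fun_prop
  · fun_prop
  · exact (measurable_pi_apply p.2).comp (measurable_snd.comp (measurable_pi_apply p.1))

theorem stick_prepend_zero (x : unitInterval × (ℕ → ℝ≥0∞))
    (ω : ℕ → unitInterval × (ℕ → ℝ≥0∞)) (j : ℕ) :
    stick (prepend (x, ω)) (0, j) = ENNReal.ofReal x.1 * x.2 j := by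
  simp [stick, prepend]

theorem stick_prepend_succ (x : unitInterval × (ℕ → ℝ≥0∞))
    (ω : ℕ → unitInterval × (ℕ → ℝ≥0∞)) (i j : ℕ) :
    stick (prepend (x, ω)) (i + 1, j) = ENNReal.ofReal (1 - x.1) * stick ω (i, j) := by
  simp only [stick, prepend]
  rw [Finset.prod_range_succ', mul_comm (∏ k ∈ Finset.range i, _), mul_assoc]

/-- Splitting off the row of index `0` from `ℕ × ℕ`. -/
def sumRowEquiv : ℕ ⊕ (ℕ × ℕ) ≃ ℕ × ℕ where
  toFun := Sum.elim (fun j => (0, j)) fun p => (p.1 + 1, p.2)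
  invFun
    | (0, j) => .inl j
    | (i + 1, j) => .inr (i, j)
  left_inv := by rintro (j | ⟨i, j⟩) <;> rfl
  right_inv := by rintro ⟨_ | i, j⟩ <;> rfl

theorem ranked_stick_prepend (x : unitInterval × (ℕ → ℝ≥0∞))
    (ω : ℕ → unitInterval × (ℕ → ℝ≥0∞)) :
    ranked (stick (prepend (x, ω))) = splice x.1 x.2 (ranked (stick ω)) := by
  rw [splice_eq_merge, merge]
  refine ranked_congr fun t => ?_
  rw [← countAbove_comp_equiv sumRowEquiv, countAbove_sumElim,
    countAbove_const_mul_congr ENNReal.ofReal_ne_top (countAbove_ranked (stick ω)),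
    ← countAbove_sumElim]
  congr 1
  funext i
  rcases i with j | ⟨i, j⟩
  · exact stick_prepend_zero x ω j
  · exact stick_prepend_succ x ω i j

/-- The total length of the pieces that are broken off a stick of length `1`. -/
noncomputable def stickMass (U : ℕ → unitInterval) : ℝ≥0∞ :=
  ∑' i, (∏ k ∈ Finset.range i, ENNReal.ofReal (1 - U k)) * ENNReal.ofReal (U i)

theorem ofReal_add_ofReal_one_sub (u : unitInterval) :
    ENNReal.ofReal u + ENNReal.ofReal (1 - u) = 1 := by
  rw [← ENNReal.ofReal_add u.2.1 (sub_nonneg.mpr u.2.2)]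
  simp

theorem stickMass_le_one (U : ℕ → unitInterval) : stickMass U ≤ 1 := by
  refine ENNReal.tsum_le_of_sum_range_le fun n => ?_
  have h : ∑ i ∈ Finset.range n,
      ((∏ k ∈ Finset.range i, ENNReal.ofReal (1 - U k)) * ENNReal.ofReal (U i))
      + ∏ k ∈ Finset.range n, ENNReal.ofReal (1 - U k) = 1 := by
    induction n with
    | zero => simp
    | succ n ih =>
      rw [Finset.sum_range_succ, Finset.prod_range_succ, add_assoc, ← mul_add,
        ofReal_add_ofReal_one_sub, mul_one, ih]
  exact h ▸ le_self_add

theorem stickMass_prepend (u : unitInterval) (U : ℕ → unitInterval) :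
    stickMass (prepend (u, U)) = ENNReal.ofReal u + ENNReal.ofReal (1 - u) * stickMass U := by
  rw [stickMass, tsum_eq_zero_add' ENNReal.summable, stickMass, ← ENNReal.tsum_mul_left]
  congr 1
  · simp [prepend]
  · refine tsum_congr fun i => ?_
    rw [Finset.prod_range_succ', mul_comm (∏ k ∈ Finset.range i, _), mul_assoc]
    rfl

theorem measurable_stickMass : Measurable stickMass := by
  refine Measurable.tsum fun i => Measurable.mul (Finset.measurable_fun_prod _ fun k _ => ?_) ?_ <;>
  fun_prop

theorem lintegral_ofReal_one_sub :
    ∫⁻ u : unitInterval, ENNReal.ofReal (1 - u) = ∫⁻ u : unitInterval, ENNReal.ofReal u := by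
  have h := unitInterval.measurePreserving_symm.lintegral_comp
    (f := fun u : unitInterval => ENNReal.ofReal u) (by fun_prop)
  simpa using h

theorem lintegral_ofReal_unitInterval_add :
    (∫⁻ u : unitInterval, ENNReal.ofReal u) + ∫⁻ u : unitInterval, ENNReal.ofReal u = 1 := by
  nth_rw 2 [← lintegral_ofReal_one_sub]
  rw [← lintegral_add_left (by fun_prop)]
  simp [ofReal_add_ofReal_one_sub]

theorem _root_.ENNReal.eq_one_of_eq_add_mul {c M : ℝ≥0∞} (hc : c + c = 1) (hM : M ≤ 1)
    (h : M = c + c * M) : M = 1 := by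
  have hc0 : c ≠ ∞ := fun h => by simp [h] at hc
  have hM0 : M ≠ ∞ := ne_top_of_le_ne_top ENNReal.one_ne_top hM
  lift c to NNReal using hc0
  lift M to NNReal using hM0
  norm_cast at hc h ⊢
  have h1 : (c : ℝ) + c = 1 := by exact_mod_cast hc
  have h2 : (M : ℝ) = c + c * M := by exact_mod_cast h
  have h3 : (c : ℝ) = 1 / 2 := by linarith
  rw [h3] at h2
  have h4 : (M : ℝ) = 1 := by linarith
  exact_mod_cast h4

/-- With independent uniform fractions nothing is left of the stick: the expected mass `M`
satisfies `M = 1 / 2 + M / 2`. -/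
theorem stickMass_ae_eq_one :
    ∀ᵐ U ∂(Measure.infinitePi fun _ : ℕ => (volume : Measure unitInterval)), stickMass U = 1 := by
  set P := Measure.infinitePi fun _ : ℕ => (volume : Measure unitInterval)
  set c := ∫⁻ u : unitInterval, ENNReal.ofReal u with hc
  set M := ∫⁻ U, stickMass U ∂P with hM
  have hc1 : c + c = 1 := lintegral_ofReal_unitInterval_add
  have hM1 : M ≤ 1 := (lintegral_mono stickMass_le_one).trans (by simp)
  have hrec : M = c + c * M := by
    have hmeas : Measurable fun p : unitInterval × (ℕ → unitInterval) =>
        ENNReal.ofReal (1 - p.1) * stickMass p.2 :=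
      Measurable.mul (by fun_prop) (measurable_stickMass.comp measurable_snd)
    have h1 : M = ∫⁻ p, stickMass (prepend p) ∂(volume : Measure unitInterval).prod P := by
      rw [← lintegral_map measurable_stickMass measurable_prepend, map_prepend_infinitePi]
    have h2 : ∀ p : unitInterval × (ℕ → unitInterval), stickMass (prepend p)
        = ENNReal.ofReal p.1 + ENNReal.ofReal (1 - p.1) * stickMass p.2 :=
      fun p => stickMass_prepend p.1 p.2
    rw [lintegral_congr h2, lintegral_add_left (by fun_prop), lintegral_prod _ (by fun_prop),
      lintegral_prod _ hmeas.aemeasurable] at h1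
    refine h1.trans ?_
    congr 1
    · simp [hc]
    · simp only
      rw [hc, ← lintegral_ofReal_one_sub, hM, ← lintegral_mul_const _ (by fun_prop)]
      exact lintegral_congr fun u => lintegral_const_mul _ measurable_stickMass
  have hcM : M = 1 := ENNReal.eq_one_of_eq_add_mul hc1 hM1 hrec
  refine ae_eq_of_ae_le_of_lintegral_le (g := fun _ => 1) (.of_forall stickMass_le_one)
    (by simp [← hM, hcM]) measurable_const.aemeasurable ?_
  simp [← hM, hcM]

/-- The law of the ranked pieces of the stick-breaking construction. -/
theorem exists_isSelfSimilarPartition {β : Measure (ℕ → ℝ≥0∞)} [IsProbabilityMeasure β]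
    (hβ : ∀ᵐ b ∂β, ∑' i, b i = 1) :
    ∃ 𝒜 : ProbabilityMeasure (ℕ → ℝ≥0∞), IsSelfSimilarPartition β 𝒜 := by
  set μ := (volume : Measure unitInterval).prod β
  set P := Measure.infinitePi fun _ : ℕ => μ
  have hm : Measurable fun ω : ℕ → unitInterval × (ℕ → ℝ≥0∞) => ranked (stick ω) :=
    measurable_ranked.comp measurable_stick
  refine ⟨⟨P.map fun ω => ranked (stick ω), Measure.isProbabilityMeasure_map hm.aemeasurable⟩,
    ?_, ?_⟩
  · have hU : ∀ᵐ ω ∂P, stickMass (fun n => (ω n).1) = 1 := by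
      have hmap : P.map (fun ω n => (ω n).1) =
          Measure.infinitePi fun _ : ℕ => (volume : Measure unitInterval) := by
        rw [Measure.infinitePi_map_pi (f := fun _ => Prod.fst) _ fun _ => measurable_fst]
        congr 1
        funext _
        simp [μ]
      have h := stickMass_ae_eq_one
      rw [← hmap] at h
      exact ae_of_ae_map (f := fun (ω : ℕ → unitInterval × (ℕ → ℝ≥0∞)) n => (ω n).1)
        (Measurable.aemeasurable (by fun_prop)) h
    have hB : ∀ᵐ ω ∂P, ∀ n, ∑' i, (ω n).2 i = 1 := by
      refine ae_all_iff.mpr fun n => ?_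
      have h1 : ∀ᵐ x ∂μ, ∑' i, x.2 i = 1 :=
        (Measure.quasiMeasurePreserving_snd (μ := (volume : Measure unitInterval))).ae hβ
      exact (measurePreserving_eval_infinitePi (fun _ : ℕ => μ) n).quasiMeasurePreserving.ae h1
    refine (ae_map_iff hm.aemeasurable ?_).mpr ?_
    · refine MeasurableSet.inter ?_ (measurableSet_eq_fun (by fun_prop) measurable_const)
      have : {a : ℕ → ℝ≥0∞ | Antitone a} = ⋂ n, {a | a (n + 1) ≤ a n} := by
        ext a
        simp only [Set.mem_iInter, Set.mem_ofPred_eq]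
        exact ⟨fun h n => h n.le_succ, antitone_nat_of_succ_le⟩
      change MeasurableSet {a : ℕ → ℝ≥0∞ | Antitone a}
      rw [this]
      exact MeasurableSet.iInter fun n =>
        measurableSet_le (measurable_pi_apply _) (measurable_pi_apply _)
    · filter_upwards [hU, hB] with ω h1 h2
      refine ⟨antitone_ranked _, ?_⟩
      rw [tsum_ranked, ENNReal.tsum_prod', ← h1, stickMass]
      refine tsum_congr fun i => ?_
      simp only [stick]
      rw [ENNReal.tsum_mul_left, ENNReal.tsum_mul_left, h2, mul_one]
  · change P.map _ = Measure.map _ ((volume : Measure unitInterval).prod (β.prod (P.map _)))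
    have h0 : P.map (fun ω => ranked (stick ω))
        = (μ.prod P).map ((fun ω => ranked (stick ω)) ∘ prepend) := by
      rw [← Measure.map_map hm measurable_prepend, map_prepend_infinitePi]
    refine h0.trans ?_
    have h1 : β.prod (P.map fun ω => ranked (stick ω))
        = (β.prod P).map (Prod.map id fun ω => ranked (stick ω)) := by
      rw [← Measure.map_prod_map _ _ measurable_id hm, Measure.map_id]
    have h2 : (volume : Measure unitInterval).prod
        (β.prod (P.map fun ω => ranked (stick ω)))
        = ((volume : Measure unitInterval).prod (β.prod P)).map
          (Prod.map id (Prod.map id fun ω => ranked (stick ω))) := by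
      rw [h1, ← Measure.map_prod_map _ _ measurable_id (measurable_id.prodMap hm), Measure.map_id]
    have h3 := (measurePreserving_prodAssoc (volume : Measure unitInterval) β P).map_eq
    rw [h2, ← h3, Measure.map_map (measurable_id.prodMap (measurable_id.prodMap hm))
        (MeasurableEquiv.measurable _),
      Measure.map_map measurable_splice (Measurable.comp
        (measurable_id.prodMap (measurable_id.prodMap hm)) (MeasurableEquiv.measurable _))]
    congr 1
    funext p
    exact ranked_stick_prepend p.1 p.2

/-! ### The distribution functions of the parts -/

theorem measurableSet_kthLargest_le (k : ℕ) (t : ℝ≥0∞) :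
    MeasurableSet {a : ℕ → ℝ≥0∞ | kthLargest a k ≤ t} :=
  measurableSet_le (measurable_kthLargest k) measurable_const

theorem antitone_phi (𝒜 : ProbabilityMeasure (ℕ → ℝ≥0∞)) (k : ℕ) : Antitone (phi 𝒜 k) := by
  intro u v huv
  refine measureReal_mono fun a ha => ?_
  rw [Set.mem_ofPred_eq] at ha ⊢
  exact ha.trans (ENNReal.div_le_div_left (ENNReal.ofReal_le_ofReal huv) 1)

theorem phi_nonneg (𝒜 : ProbabilityMeasure (ℕ → ℝ≥0∞)) (k : ℕ) (u : ℝ) : 0 ≤ phi 𝒜 k u :=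
  measureReal_nonneg

theorem phi_le_one (𝒜 : ProbabilityMeasure (ℕ → ℝ≥0∞)) (k : ℕ) (u : ℝ) : phi 𝒜 k u ≤ 1 :=
  measureReal_le_one

theorem phi_eq_one {β : Measure (ℕ → ℝ≥0∞)} {𝒜 : ProbabilityMeasure (ℕ → ℝ≥0∞)}
    (hA : IsSelfSimilarPartition β 𝒜) {k : ℕ} (hk : 0 < k) {u : ℝ} (hu : u ≤ 1) :
    phi 𝒜 k u = 1 := by
  rw [phi, ← probReal_univ (μ := (𝒜 : Measure (ℕ → ℝ≥0∞)))]
  refine measureReal_congr ?_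
  filter_upwards [hA.1] with a ha
  refine propext (iff_of_true ?_ trivial)
  change kthLargest a k ≤ _
  rw [kthLargest_le_iff a k hk]
  have : {i | 1 / ENNReal.ofReal u < a i} = ∅ := by
    ext i
    simp only [Set.mem_ofPred_eq, Set.mem_empty_iff_false, iff_false, not_lt]
    refine ((ENNReal.le_tsum i).trans_eq ha.2).trans ?_
    rw [one_div, ENNReal.one_le_inv]
    exact ENNReal.ofReal_le_one.mpr hu
  rw [this, Set.encard_empty]
  exact_mod_cast hk

/-- For a finite threshold, `j` is the number of terms above it exactly when it lies between the
`(j + 1)`-th and the `j`-th largest term. -/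
theorem countAbove_eq_iff {ι : Type*} (b : ι → ℝ≥0∞) (j : ℕ) {t : ℝ≥0∞} (ht : t ≠ ∞) :
    countAbove b t = j ↔ kthLargest b (j + 1) ≤ t ∧ t < kthLargest b j := by
  rw [kthLargest_le_iff b _ j.succ_pos, Nat.cast_succ]
  change _ ↔ countAbove b t < _ ∧ _
  rw [ENat.lt_add_one_iff (ENat.natCast_ne_top j)]
  rcases Nat.eq_zero_or_pos j with rfl | hj
  · simp [kthLargest_zero, ht.lt_top]
  · rw [lt_kthLargest_iff b hj, le_antisymm_iff]

theorem natCast_add_lt_iff {j k : ℕ} (N : ℕ∞) (h : j < k) :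
    (j : ℕ∞) + N < k ↔ N < (k - j : ℕ) := by
  induction N using ENat.recTopCoe with
  | top => simp
  | coe n =>
    norm_cast
    omega

theorem sum_indicator_mul_eq {Ω : Type*} (N : Ω → ℕ∞) (b : Ω) (k : ℕ) (f : ℕ → ℝ) :
    ∑ j ∈ Finset.range k, {b | N b = j}.indicator (1 : Ω → ℝ) b * f j
      = if N b < k then f (N b).toNat else 0 := by
  split_ifs with h
  · obtain ⟨n, hn⟩ := ENat.ne_top_iff_exists.mp (ne_top_of_lt h)
    rw [← hn] at h ⊢
    have hnk : n < k := by exact_mod_cast h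
    rw [Finset.sum_eq_single n]
    · simp [← hn]
    · intro j _ hj
      have : ¬ N b = j := by
        rw [← hn]
        exact_mod_cast hj.symm
      simp [this]
    · intro h'
      exact absurd (Finset.mem_range.mpr hnk) h'
  · refine Finset.sum_eq_zero fun j hj => ?_
    have : ¬ N b = j := by
      intro h'
      rw [h'] at h
      exact h (by exact_mod_cast Finset.mem_range.mp hj)
    simp [this]

theorem measurableSet_countAbove_eq (j : ℕ) {t : ℝ≥0∞} (ht : t ≠ ∞) :
    MeasurableSet {b : ℕ → ℝ≥0∞ | countAbove b t = j} := by
  simp only [countAbove_eq_iff _ _ ht]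
  exact (measurableSet_kthLargest_le _ _).inter
    (measurableSet_lt measurable_const (measurable_kthLargest j))

/-- The number of terms of a merged sequence above a threshold is the sum of two independent
counts, decomposed along the value `j` of the first. -/
theorem integral_integral_indicator_merge {β α : Measure (ℕ → ℝ≥0∞)} [IsProbabilityMeasure β]
    [IsProbabilityMeasure α] {k : ℕ} (hk : 0 < k) {c d t : ℝ≥0∞} (hc : c ≠ 0) (hc' : c ≠ ∞)
    (hd : d ≠ 0) (hd' : d ≠ ∞) (ht : t / c ≠ ∞) :
    ∫ b, ∫ a, {x : ℕ → ℝ≥0∞ | kthLargest x k ≤ t}.indicator (1 : (ℕ → ℝ≥0∞) → ℝ)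
        (merge (fun i => c * b i) (fun i => d * a i)) ∂α ∂β
      = ∑ j ∈ Finset.range k, β.real {b | countAbove b (t / c) = j} *
        α.real {a | kthLargest a (k - j) ≤ t / d} := by
  have h1 : ∀ b : ℕ → ℝ≥0∞,
      ∫ a, {x : ℕ → ℝ≥0∞ | kthLargest x k ≤ t}.indicator (1 : (ℕ → ℝ≥0∞) → ℝ)
        (merge (fun i => c * b i) (fun i => d * a i)) ∂α
      = ∑ j ∈ Finset.range k, {b | countAbove b (t / c) = j}.indicator (1 : (ℕ → ℝ≥0∞) → ℝ) b *
        α.real {a | kthLargest a (k - j) ≤ t / d} := by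
    intro b
    rw [sum_indicator_mul_eq (fun b => countAbove b (t / c)) b k
      (fun j => α.real {a | kthLargest a (k - j) ≤ t / d})]
    have hmem : ∀ a : ℕ → ℝ≥0∞, merge (fun i => c * b i) (fun i => d * a i) ∈
        {x : ℕ → ℝ≥0∞ | kthLargest x k ≤ t} ↔
          countAbove b (t / c) + countAbove a (t / d) < k := by
      intro a
      rw [Set.mem_ofPred_eq, kthLargest_le_iff _ k hk]
      change countAbove _ t < _ ↔ _
      rw [countAbove_merge, countAbove_const_mul hc hc', countAbove_const_mul hd hd']
    split_ifs with h
    · obtain ⟨n, hn⟩ := ENat.ne_top_iff_exists.mp (ne_top_of_lt h)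
      have hnk : n < k := by
        rw [← hn] at h
        exact_mod_cast h
      rw [← integral_indicator_one (measurableSet_kthLargest_le _ _)]
      refine integral_congr_ae (.of_forall fun a => ?_)
      simp only [Set.indicator, hmem, ← hn, natCast_add_lt_iff _ hnk, ENat.toNat_natCast,
        Set.mem_ofPred_eq, kthLargest_le_iff a (k - n) (Nat.sub_pos_of_lt hnk)]
      rfl
    · have : ∀ a : ℕ → ℝ≥0∞, ¬ countAbove b (t / c) + countAbove a (t / d) < k :=
        fun a h' => h (lt_of_le_of_lt le_self_add h')
      simp [Set.indicator, hmem, this]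
  rw [integral_congr_ae (.of_forall h1), integral_finsetSum]
  · refine Finset.sum_congr rfl fun j _ => ?_
    rw [integral_mul_const, integral_indicator_one (measurableSet_countAbove_eq j ht)]
  · intro j _
    exact ((integrable_const (1 : ℝ)).indicator (measurableSet_countAbove_eq j ht)).mul_const _

/-- The set of pairs `(x, ω)` with `ℬ_{j+1} ≤ 1 / x < ℬ_j`, for a random sequence `ℬ = B ω`. -/
theorem measurableSet_between {Ω : Type*} [MeasurableSpace Ω] {B : Ω → ℕ → ℝ≥0∞}
    (hB : Measurable B) (j : ℕ) :
    MeasurableSet {p : ℝ × Ω | kthLargest (B p.2) (j + 1) ≤ 1 / ENNReal.ofReal p.1 ∧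
      1 / ENNReal.ofReal p.1 < kthLargest (B p.2) j} := by
  have h1 : Measurable fun p : ℝ × Ω => 1 / ENNReal.ofReal p.1 := by fun_prop
  have h2 : ∀ k, Measurable fun p : ℝ × Ω => kthLargest (B p.2) k := fun k =>
    (measurable_kthLargest k).comp (hB.comp measurable_snd)
  exact (measurableSet_le (h2 _) h1).inter (measurableSet_lt h1 (h2 _))

theorem measurable_measureReal_between {Ω : Type*} [MeasurableSpace Ω] {B : Ω → ℕ → ℝ≥0∞}
    (hB : Measurable B) (μ : Measure Ω) [IsProbabilityMeasure μ] (j : ℕ) :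
    Measurable fun x : ℝ => μ.real {ω | kthLargest (B ω) (j + 1) ≤ 1 / ENNReal.ofReal x ∧
      1 / ENNReal.ofReal x < kthLargest (B ω) j} :=
  (measurable_measure_prodMk_left (measurableSet_between hB j)).ennreal_toReal

theorem measurable_phi_sub (𝒜 : ProbabilityMeasure (ℕ → ℝ≥0∞)) (k : ℕ) (u : ℝ) :
    Measurable fun x => phi 𝒜 k (u - x) :=
  (antitone_phi 𝒜 k).measurable.comp (measurable_const.sub measurable_id)

/-- The convolution form of the recursion. -/
theorem IsSelfSimilarPartition.mul_phi_eq {Ω : Type*} [MeasurableSpace Ω] {μ : Measure Ω}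
    [IsProbabilityMeasure μ] {B : Ω → ℕ → ℝ≥0∞} (hB : Measurable B)
    {𝒜 : ProbabilityMeasure (ℕ → ℝ≥0∞)} (hA : IsSelfSimilarPartition (μ.map B) 𝒜) {k : ℕ}
    (hk : 0 < k) {u : ℝ} (hu : 0 < u) :
    u * phi 𝒜 k u = ∑ j ∈ Finset.range k, ∫ x in (0 : ℝ)..u,
      μ.real {ω | kthLargest (B ω) (j + 1) ≤ 1 / ENNReal.ofReal x ∧
        1 / ENNReal.ofReal x < kthLargest (B ω) j} * phi 𝒜 (k - j) (u - x) := by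
  have : IsProbabilityMeasure (μ.map B) := Measure.isProbabilityMeasure_map hB.aemeasurable
  have hint : ∀ j ∈ Finset.range k, IntervalIntegrable (fun x =>
      μ.real {ω | kthLargest (B ω) (j + 1) ≤ 1 / ENNReal.ofReal x ∧
        1 / ENNReal.ofReal x < kthLargest (B ω) j} * phi 𝒜 (k - j) (u - x)) volume 0 u := by
    intro j _
    have hm := (measurable_measureReal_between hB μ j).mul (measurable_phi_sub 𝒜 (k - j) u)
    have hb : ∃ C, ∀ x, |μ.real {ω | kthLargest (B ω) (j + 1) ≤ 1 / ENNReal.ofReal x ∧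
        1 / ENNReal.ofReal x < kthLargest (B ω) j} * phi 𝒜 (k - j) (u - x)| ≤ C := by
      refine ⟨1, fun x => ?_⟩
      rw [abs_of_nonneg (mul_nonneg measureReal_nonneg (phi_nonneg _ _ _))]
      exact mul_le_one₀ measureReal_le_one (phi_nonneg _ _ _) (phi_le_one _ _ _)
    exact ⟨integrable_of_bounded hm hb, integrable_of_bounded hm hb⟩
  rw [← intervalIntegral.integral_finsetSum hint]
  have hscale := intervalIntegral.mul_integral_comp_mul_left (a := 0) (b := 1) (c := u)
    (f := fun x => ∑ j ∈ Finset.range k,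
      μ.real {ω | kthLargest (B ω) (j + 1) ≤ 1 / ENNReal.ofReal x ∧
        1 / ENNReal.ofReal x < kthLargest (B ω) j} * phi 𝒜 (k - j) (u - x))
  rw [mul_zero, mul_one] at hscale
  rw [← hscale]
  congr 1
  have hset := measurableSet_kthLargest_le k (1 / ENNReal.ofReal u)
  have hphi : phi 𝒜 k u = ∫ a, {x : ℕ → ℝ≥0∞ | kthLargest x k ≤ 1 / ENNReal.ofReal u}.indicator
      (1 : (ℕ → ℝ≥0∞) → ℝ) a ∂(𝒜 : Measure (ℕ → ℝ≥0∞)) := (integral_indicator_one hset).symm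
  rw [hphi, hA.integral_eq (measurable_one.indicator hset) ⟨1, fun x => by
    simp only [Set.indicator]; split_ifs <;> simp⟩]
  refine intervalIntegral.integral_congr_ae' ?_ (by simp)
  filter_upwards [(measure_eq_zero_iff_ae_notMem.mp (measure_singleton (1 : ℝ)) :
    ∀ᵐ v : ℝ, v ∉ ({1} : Set ℝ))] with v hv1 hv
  have hv0 : 0 < v := hv.1
  have hv1' : 0 < 1 - v := sub_pos.mpr (lt_of_le_of_ne hv.2 hv1)
  have hdiv : ∀ w : ℝ, 0 < w →
      1 / ENNReal.ofReal u / ENNReal.ofReal w = 1 / ENNReal.ofReal (u * w) := by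
    intro w hw
    rw [ENNReal.ofReal_mul hu.le, one_div, one_div, ENNReal.mul_inv, div_eq_mul_inv]
    · exact .inl (by simpa using hu)
    · exact .inl ENNReal.ofReal_ne_top
  have htop : 1 / ENNReal.ofReal (u * v) ≠ ∞ := by
    rw [one_div]
    simpa using mul_pos hu hv0
  rw [integral_integral_indicator_merge hk (by simpa using hv0) ENNReal.ofReal_ne_top
    (by simpa using hv1') ENNReal.ofReal_ne_top (by rwa [hdiv v hv0])]
  refine Finset.sum_congr rfl fun j _ => ?_
  rw [hdiv v hv0, hdiv _ hv1', mul_sub, mul_one]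
  congr 1
  rw [map_measureReal_apply hB (measurableSet_countAbove_eq j htop)]
  simp only [countAbove_eq_iff _ _ htop, Set.preimage_ofPred_eq]

/-- Substituting `y = u - x` turns the condition `b ≤ 1 / x < c` into an interval for `y`. -/
theorem integral_indicator_between {b c : ℝ≥0∞} (hbc : b ≤ c) {u : ℝ} (hu : 0 < u) (f : ℝ → ℝ) :
    ∫ x in (0 : ℝ)..u, {x : ℝ | b ≤ 1 / ENNReal.ofReal x ∧ 1 / ENNReal.ofReal x < c}.indicator
        (fun x => f (u - x)) x
      = ∫ y in (ENNReal.ofReal u - 1 / b).toReal..(ENNReal.ofReal u - 1 / c).toReal, f y := by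
  set p := (ENNReal.ofReal u - 1 / b).toReal with hp
  set q := (ENNReal.ofReal u - 1 / c).toReal with hq
  have hpq : p ≤ q := ENNReal.toReal_mono (by simp)
    (tsub_le_tsub_left (ENNReal.div_le_div_left hbc 1) _)
  have hqu : q ≤ u := by
    have := ENNReal.toReal_mono (b := ENNReal.ofReal u) (by simp) (tsub_le_self (b := 1 / c))
    rwa [ENNReal.toReal_ofReal hu.le] at this
  have hp0 : 0 ≤ p := ENNReal.toReal_nonneg
  have h1 : ∀ x ∈ Set.Ioc 0 u,
      {x : ℝ | b ≤ 1 / ENNReal.ofReal x ∧ 1 / ENNReal.ofReal x < c}.indicator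
        (fun x => f (u - x)) x = (Set.Ico p q).indicator f (u - x) := by
    intro x hx
    have hx0 : 0 < x := hx.1
    have e1 : b ≤ 1 / ENNReal.ofReal x ↔ p ≤ u - x := by
      rw [one_div, ENNReal.le_inv_iff_le_inv, ← one_div]
      rw [hp, ← ENNReal.le_ofReal_iff_toReal_le (by simp) (sub_nonneg.mpr hx.2),
        ENNReal.ofReal_sub _ hx0.le, tsub_le_iff_right]
      constructor
      · intro h
        calc ENNReal.ofReal u = ENNReal.ofReal u - ENNReal.ofReal x + ENNReal.ofReal x :=
              (tsub_add_cancel_of_le (ENNReal.ofReal_le_ofReal hx.2)).symm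
          _ ≤ _ := by gcongr
      · intro h
        have h2 := (tsub_add_cancel_of_le (ENNReal.ofReal_le_ofReal hx.2)).trans_le h
        exact (ENNReal.add_le_add_iff_left (by simp)).mp h2
    have e2 : 1 / ENNReal.ofReal x < c ↔ u - x < q := by
      rw [one_div, ENNReal.inv_lt_iff_inv_lt, ← one_div]
      rw [hq, ← ENNReal.ofReal_lt_iff_lt_toReal (sub_nonneg.mpr hx.2) (by simp),
        ENNReal.ofReal_sub _ hx0.le, lt_tsub_iff_right]
      constructor
      · intro h
        calc _ < ENNReal.ofReal u - ENNReal.ofReal x + ENNReal.ofReal x :=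
              ENNReal.add_lt_add_left (by simp) h
          _ = _ := tsub_add_cancel_of_le (ENNReal.ofReal_le_ofReal hx.2)
      · intro h
        have h2 := h.trans_eq (tsub_add_cancel_of_le (ENNReal.ofReal_le_ofReal hx.2)).symm
        exact (ENNReal.add_lt_add_iff_left (by simp)).mp h2
    simp only [Set.indicator, Set.mem_ofPred_eq, Set.mem_Ico, e1, e2]
  rw [intervalIntegral.integral_congr_ae (g := fun x => (Set.Ico p q).indicator f (u - x))
    (.of_forall fun x hx => h1 x (by rwa [Set.uIoc_of_le hu.le] at hx)),
    intervalIntegral.integral_comp_sub_left (fun y => (Set.Ico p q).indicator f y), sub_self,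
    sub_zero, intervalIntegral.integral_of_le hu.le, intervalIntegral.integral_of_le hpq,
    ← integral_Ico_eq_integral_Ioc, ← integral_Ico_eq_integral_Ioc,
    setIntegral_indicator measurableSet_Ico]
  congr 2
  exact Set.inter_eq_right.mpr (Set.Ico_subset_Ico hp0 hqu)

/-- The two forms of the recursion agree term by term. -/
theorem integral_between_mul_eq {Ω : Type*} [MeasurableSpace Ω] {μ : Measure Ω}
    [IsProbabilityMeasure μ] {B : Ω → ℕ → ℝ≥0∞} (hB : Measurable B) (j : ℕ) {u : ℝ} (hu : 0 < u)
    {f : ℝ → ℝ} (hf : Antitone f) (hf0 : ∀ x, 0 ≤ f x) (hf1 : ∀ x, f x ≤ 1) :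
    ∫ x in (0 : ℝ)..u, μ.real {ω | kthLargest (B ω) (j + 1) ≤ 1 / ENNReal.ofReal x ∧
        1 / ENNReal.ofReal x < kthLargest (B ω) j} * f (u - x)
      = ∫ ω, (∫ y in (ENNReal.ofReal u - 1 / kthLargest (B ω) (j + 1)).toReal..
          (ENNReal.ofReal u - 1 / kthLargest (B ω) j).toReal, f y) ∂μ := by
  set E := {p : ℝ × Ω | kthLargest (B p.2) (j + 1) ≤ 1 / ENNReal.ofReal p.1 ∧
      1 / ENNReal.ofReal p.1 < kthLargest (B p.2) j} with hE
  have hEm : MeasurableSet E := measurableSet_between hB j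
  have hsub : Measurable fun x => f (u - x) :=
    hf.measurable.comp (measurable_const.sub measurable_id)
  have hm : Measurable (E.indicator fun p : ℝ × Ω => f (u - p.1)) :=
    (hsub.comp measurable_fst).indicator hEm
  have hb : ∃ C, ∀ p, |E.indicator (fun p : ℝ × Ω => f (u - p.1)) p| ≤ C := by
    refine ⟨1, fun p => ?_⟩
    simp only [Set.indicator]
    split_ifs
    · rw [abs_of_nonneg (hf0 _)]
      exact hf1 _
    · simp
  have h1 : ∀ x : ℝ, μ.real {ω | kthLargest (B ω) (j + 1) ≤ 1 / ENNReal.ofReal x ∧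
        1 / ENNReal.ofReal x < kthLargest (B ω) j} * f (u - x)
      = ∫ ω, E.indicator (fun p : ℝ × Ω => f (u - p.1)) (x, ω) ∂μ := by
    intro x
    have hsec : MeasurableSet {ω | kthLargest (B ω) (j + 1) ≤ 1 / ENNReal.ofReal x ∧
        1 / ENNReal.ofReal x < kthLargest (B ω) j} := measurable_prodMk_left hEm
    rw [← smul_eq_mul, ← integral_indicator_const (f (u - x)) hsec]
    rfl
  have h2 : ∀ ω : Ω, (∫ y in (ENNReal.ofReal u - 1 / kthLargest (B ω) (j + 1)).toReal..
          (ENNReal.ofReal u - 1 / kthLargest (B ω) j).toReal, f y)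
      = ∫ x in Set.Ioc 0 u, E.indicator (fun p : ℝ × Ω => f (u - p.1)) (x, ω) := by
    intro ω
    rw [← integral_indicator_between (kthLargest_antitone (B ω) j.le_succ) hu f,
      intervalIntegral.integral_of_le hu.le]
    rfl
  simp only [h1, h2]
  rw [intervalIntegral.integral_of_le hu.le]
  exact integral_integral_swap (integrable_of_bounded hm hb)

/-! ### Weighted cycles of a permutation -/

section Cycles

variable {X Y Q : Type*}

/-- The cycle of a point. -/
def cycleMk (σ : Equiv.Perm X) (x : X) : Cycles σ := Quotient.mk _ x

theorem cycleMk_apply (σ : Equiv.Perm X) (x : X) : cycleMk σ (σ x) = cycleMk σ x :=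
  Quotient.sound (s := Equiv.Perm.SameCycle.setoid σ) (Equiv.Perm.sameCycle_apply_left.mpr
    (Equiv.Perm.SameCycle.refl σ x))

theorem eq_of_sameCycle_of_invariant {σ : Equiv.Perm X} {f : X → Q} (hf : ∀ x, f (σ x) = f x)
    {x y : X} (h : σ.SameCycle x y) : f x = f y := by
  obtain ⟨i, rfl⟩ := h
  induction i using Int.induction_on with
  | zero => rfl
  | succ i ih =>
    rw [ih, add_comm, zpow_add, zpow_one, Equiv.Perm.mul_apply, hf]
  | pred i ih =>
    rw [ih, ← hf ((σ ^ (-(i : ℤ) - 1)) x), ← Equiv.Perm.mul_apply, ← zpow_one_add]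
    congr 3
    ring

/-- A function that is invariant under `σ` descends to the cycles of `σ`. -/
def cyclesLift (σ : Equiv.Perm X) (f : X → Q) (hf : ∀ x, f (σ x) = f x) : Cycles σ → Q :=
  Quotient.lift (s := Equiv.Perm.SameCycle.setoid σ) f
    fun _ _ h => eq_of_sameCycle_of_invariant hf h

theorem Cycles.ind {σ : Equiv.Perm X} {p : Cycles σ → Prop} (h : ∀ x, p (cycleMk σ x))
    (c : Cycles σ) : p c :=
  Quotient.ind h c

/-- Maps in both directions that respect the cycles, and are inverse to each other up to cycles,
identify the cycles of two permutations. -/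
def cyclesEquiv {σ : Equiv.Perm X} {τ : Equiv.Perm Y} (f : X → Y) (s : Y → X)
    (hf : ∀ x, cycleMk τ (f (σ x)) = cycleMk τ (f x))
    (hs : ∀ y, cycleMk σ (s (τ y)) = cycleMk σ (s y))
    (hsf : ∀ x, cycleMk σ (s (f x)) = cycleMk σ x) (hfs : ∀ y, cycleMk τ (f (s y)) = cycleMk τ y) :
    Cycles σ ≃ Cycles τ where
  toFun := cyclesLift σ (fun x => cycleMk τ (f x)) hf
  invFun := cyclesLift τ (fun y => cycleMk σ (s y)) hs
  left_inv := Cycles.ind hsf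
  right_inv := Cycles.ind hfs

open Classical in
/-- The weight of a cycle: the sum of the weights of its points. -/
noncomputable def cycleWeight [Fintype X] (σ : Equiv.Perm X) (w : X → ℝ≥0∞) (c : Cycles σ) :
    ℝ≥0∞ :=
  ∑ x, if cycleMk σ x = c then w x else 0

theorem cycleWeight_const [Fintype X] (σ : Equiv.Perm X) (a : ℝ≥0∞) (c : Cycles σ) :
    cycleWeight σ (fun _ => a) c = a * cycleLength σ c := by
  classical
  rw [cycleWeight, ← Finset.sum_filter, Finset.sum_const, nsmul_eq_mul, mul_comm, cycleLength,
    Nat.card_eq_fintype_card, Fintype.card_subtype]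
  rfl

/-- The cycles of the disjoint union of two permutations. -/
def cyclesSumCongr (σ : Equiv.Perm X) (τ : Equiv.Perm Y) :
    Cycles σ ⊕ Cycles τ ≃ Cycles (Equiv.Perm.sumCongr σ τ) where
  toFun := Sum.elim
    (cyclesLift σ (fun x => cycleMk (Equiv.Perm.sumCongr σ τ) (.inl x))
      fun x => cycleMk_apply (Equiv.Perm.sumCongr σ τ) (.inl x))
    (cyclesLift τ (fun y => cycleMk (Equiv.Perm.sumCongr σ τ) (.inr y))
      fun y => cycleMk_apply (Equiv.Perm.sumCongr σ τ) (.inr y))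
  invFun := cyclesLift _ (Sum.elim (fun x => .inl (cycleMk σ x)) (fun y => .inr (cycleMk τ y))) <| by
    rintro (x | y)
    · exact congrArg Sum.inl (cycleMk_apply σ x)
    · exact congrArg Sum.inr (cycleMk_apply τ y)
  left_inv := by
    rintro (c | c)
    · induction c using Cycles.ind with | h x => rfl
    · induction c using Cycles.ind with | h y => rfl
  right_inv := Cycles.ind <| by rintro (x | y) <;> rfl

theorem countAbove_cycleWeight_sumCongr [Fintype X] [Fintype Y] (σ : Equiv.Perm X)
    (τ : Equiv.Perm Y) (w : X ⊕ Y → ℝ≥0∞) (t : ℝ≥0∞) :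
    countAbove (cycleWeight (Equiv.Perm.sumCongr σ τ) w) t =
      countAbove (cycleWeight σ fun x => w (.inl x)) t +
        countAbove (cycleWeight τ fun y => w (.inr y)) t := by
  classical
  rw [← countAbove_comp_equiv (cyclesSumCongr σ τ), ← countAbove_sumElim]
  congr 1
  funext c
  have hinv : ∀ z, cycleMk (Equiv.Perm.sumCongr σ τ) z = cyclesSumCongr σ τ c ↔
      Sum.elim (fun x => .inl (cycleMk σ x)) (fun y => .inr (cycleMk τ y)) z = c :=
    fun z => ((cyclesSumCongr σ τ).symm_apply_eq (x := cycleMk _ z)).symm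
  rw [cycleWeight, Fintype.sum_sum_type]
  simp only [hinv, Sum.elim_inl, Sum.elim_inr]
  rcases c with c | c <;> simp [cycleWeight]

end Cycles

/-! ### Cycles of block permutations -/

section Blocks

variable {α α' κ : Type*} {Γ : Subgroup (Equiv.Perm κ)}

/-- The permutation `(g; h)` of the blocks `{i} × κ`, which permutes the block of index `i` by
`g i` and then permutes the blocks by `h`. -/
def blockPerm (g : α → Γ) (h : Equiv.Perm α) : Equiv.Perm (α × κ) where
  toFun p := (h p.1, (g p.1 : Equiv.Perm κ) p.2)
  invFun p := (h.symm p.1, (g (h.symm p.1) : Equiv.Perm κ).symm p.2)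
  left_inv p := by simp
  right_inv p := by simp

theorem blockPerm_apply (g : α → Γ) (h : Equiv.Perm α) (i : α) (x : κ) :
    blockPerm g h (i, x) = (h i, (g i : Equiv.Perm κ) x) := rfl

/-- The weights of the cycles of a block permutation, if the points of the block of index `i` have
weight `w i`. -/
noncomputable def blockWeights [Fintype α] [Fintype κ] (w : α → ℝ≥0∞) (g : α → Γ)
    (h : Equiv.Perm α) : Cycles (blockPerm g h) → ℝ≥0∞ :=
  cycleWeight (blockPerm g h) fun p => w p.1

theorem countAbove_blockWeights_relabel [Fintype α] [Fintype α'] [Fintype κ] (e : α ≃ α')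
    (w : α' → ℝ≥0∞) (g : α' → Γ) (h : Equiv.Perm α') (t : ℝ≥0∞) :
    countAbove (blockWeights (fun i => w (e i)) (fun i => g (e i)) (e.symm.permCongr h)) t =
      countAbove (blockWeights w g h) t := by
  classical
  set τ := blockPerm g h with hτ
  set σ := blockPerm (fun i => g (e i)) (e.symm.permCongr h) with hσ
  have hconj : ∀ p : α × κ, Prod.map e id (σ p) = τ (Prod.map e id p) := by
    rintro ⟨i, x⟩
    simp [hσ, hτ, blockPerm_apply]
  have hconj' : ∀ p : α' × κ, Prod.map e.symm id (τ p) = σ (Prod.map e.symm id p) := by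
    rintro ⟨i, x⟩
    simp [hσ, hτ, blockPerm_apply]
  set E : Cycles σ ≃ Cycles τ := cyclesEquiv (Prod.map e id) (Prod.map e.symm id)
    (fun p => by rw [hconj, cycleMk_apply]) (fun p => by rw [hconj', cycleMk_apply])
    (fun p => congrArg _ (Prod.ext (e.symm_apply_apply p.1) rfl))
    (fun p => congrArg _ (Prod.ext (e.apply_symm_apply p.1) rfl))
  rw [← countAbove_comp_equiv E]
  congr 1
  funext c
  have hE : ∀ p, cycleMk τ (Prod.map e id p) = E c ↔ cycleMk σ p = c :=
    fun p => E.apply_eq_iff_eq (x := cycleMk σ p)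
  rw [blockWeights, blockWeights, cycleWeight, cycleWeight,
    ← (e.prodCongr (Equiv.refl κ)).sum_comp]
  refine Finset.sum_congr rfl fun p _ => ?_
  refine if_congr (hE p).symm rfl rfl

/-- If `h` fixes the block `none`, then the cycles of `(g; h)` are those of `g none` together with
those in the other blocks. -/
theorem countAbove_blockWeights_none [Fintype α] [DecidableEq α] [Fintype κ] (w : Option α → ℝ≥0∞)
    (g : Option α → Γ) (h : Equiv.Perm α) (t : ℝ≥0∞) :
    countAbove (blockWeights w g (Equiv.Perm.decomposeOption.symm (none, h))) t =
      countAbove (cycleWeight (g none : Equiv.Perm κ) fun _ => w none) t +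
        countAbove (blockWeights (fun i => w (some i)) (fun i => g (some i)) h) t := by
  classical
  set ĥ := Equiv.Perm.decomposeOption.symm (none, h) with hĥ
  have h0 : ĥ none = none := by simp [hĥ]
  have h1 : ∀ i, ĥ (some i) = some (h i) := fun i => by simp [hĥ]
  set ρ := Equiv.Perm.sumCongr (g none : Equiv.Perm κ) (blockPerm (fun i => g (some i)) h) with hρ
  set σ := blockPerm g ĥ with hσ
  -- the blocks over `Option α` are the block `none` and the blocks over `α`
  let e : κ ⊕ α × κ ≃ Option α × κ :=
    { toFun := Sum.elim (fun x => (none, x)) fun p => (some p.1, p.2)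
      invFun := fun p => p.1.elim (.inl p.2) fun i => .inr (i, p.2)
      left_inv := by rintro (x | ⟨i, x⟩) <;> rfl
      right_inv := by rintro ⟨_ | i, x⟩ <;> rfl }
  have hconj : ∀ z, e (ρ z) = σ (e z) := by
    rintro (x | ⟨i, x⟩)
    · simp [e, hρ, hσ, blockPerm_apply, h0]
    · simp [e, hρ, hσ, blockPerm_apply, h1]
  have hconj' : ∀ z, e.symm (σ z) = ρ (e.symm z) := fun z => by
    rw [Equiv.symm_apply_eq, hconj, e.apply_symm_apply]
  set E : Cycles ρ ≃ Cycles σ := cyclesEquiv e e.symm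
    (fun p => by rw [hconj, cycleMk_apply]) (fun p => by rw [hconj', cycleMk_apply])
    (fun p => by simp) (fun p => by simp)
  rw [← countAbove_comp_equiv E]
  refine Eq.trans (congrArg (fun a => countAbove a t) (funext fun c => ?_))
    (countAbove_cycleWeight_sumCongr (g none : Equiv.Perm κ) (blockPerm (fun i => g (some i)) h)
      (fun z => w (e z).1) t)
  have hE : ∀ z, cycleMk σ (e z) = E c ↔ cycleMk ρ z = c :=
    fun z => E.apply_eq_iff_eq (x := cycleMk ρ z)
  rw [blockWeights, cycleWeight, cycleWeight, ← e.sum_comp]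
  exact Finset.sum_congr rfl fun z _ => if_congr (hE z) rfl rfl

/-- If `h` maps the block `none` to the block `q`, then the block `none` can be contracted into
the block `q` without changing the weights of the cycles: the weight of `q` grows by that of
`none`, and the permutation of the block that is mapped to `none` is followed by that of `none`. -/
theorem countAbove_blockWeights_some [Fintype α] [DecidableEq α] [Fintype κ] (w : Option α → ℝ≥0∞)
    (g : Option α → Γ) (q : α) (h : Equiv.Perm α) (t : ℝ≥0∞) :
    countAbove (blockWeights w g (Equiv.Perm.decomposeOption.symm (some q, h))) t =
      countAbove (blockWeights ((fun i => w (some i)) + Pi.single q (w none))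
        (Pi.mulSingle (h.symm q) (g none) * fun i => g (some i)) h) t := by
  classical
  set ĥ := Equiv.Perm.decomposeOption.symm (some q, h) with hĥ
  have h0 : ĥ none = some q := by simp [hĥ]
  have h1 : ∀ i, h i ≠ q → ĥ (some i) = some (h i) := fun i hi => by
    simp [hĥ, Equiv.swap_apply_of_ne_of_ne, hi]
  have h2 : ∀ i, h i = q → ĥ (some i) = none := fun i hi => by simp [hĥ, hi]
  set g' : α → Γ := Pi.mulSingle (h.symm q) (g none) * fun i => g (some i) with hg'
  have hg1 : ∀ i, h i ≠ q → g' i = g (some i) := fun i hi => by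
    have : i ≠ h.symm q := fun h' => hi (by rw [h', h.apply_symm_apply])
    simp [hg', Pi.mulSingle_eq_of_ne this]
  have hg2 : ∀ i, h i = q → g' i = g none * g (some i) := fun i hi => by
    have : i = h.symm q := by rw [← hi, h.symm_apply_apply]
    subst this
    simp [hg']
  set σ := blockPerm g ĥ with hσ
  set τ := blockPerm g' h with hτ
  let f : Option α × κ → α × κ := fun p =>
    p.1.elim (q, (g none : Equiv.Perm κ) p.2) fun i => (i, p.2)
  let s : α × κ → Option α × κ := fun p => (some p.1, p.2)
  have hf : ∀ p, cycleMk τ (f (σ p)) = cycleMk τ (f p) := by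
    rintro ⟨_ | i, x⟩
    · simp [f, hσ, blockPerm_apply, h0]
    · by_cases hi : h i = q
      · have : f (σ (some i, x)) = τ (i, x) := by
          simp [f, hσ, hτ, blockPerm_apply, h2 i hi, hi, hg2 i hi]
        rw [this, cycleMk_apply]
        rfl
      · have : f (σ (some i, x)) = τ (i, x) := by
          simp [f, hσ, hτ, blockPerm_apply, h1 i hi, hg1 i hi]
        rw [this, cycleMk_apply]
        rfl
  have hs : ∀ p, cycleMk σ (s (τ p)) = cycleMk σ (s p) := by
    rintro ⟨i, x⟩
    by_cases hi : h i = q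
    · have : s (τ (i, x)) = σ (σ (some i, x)) := by
        simp [s, hσ, hτ, blockPerm_apply, h2 i hi, h0, hi, hg2 i hi]
      rw [this, cycleMk_apply, cycleMk_apply]
    · have : s (τ (i, x)) = σ (some i, x) := by
        simp [s, hσ, hτ, blockPerm_apply, h1 i hi, hg1 i hi]
      rw [this, cycleMk_apply]
  have hsf : ∀ p, cycleMk σ (s (f p)) = cycleMk σ p := by
    rintro ⟨_ | i, x⟩
    · have : s (f (none, x)) = σ (none, x) := by simp [s, f, hσ, blockPerm_apply, h0]
      rw [this, cycleMk_apply]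
    · rfl
  set E : Cycles σ ≃ Cycles τ := cyclesEquiv f s hf hs hsf fun _ => rfl
  rw [← countAbove_comp_equiv E]
  congr 1
  funext c
  have hE : ∀ p, cycleMk τ (f p) = E c ↔ cycleMk σ p = c :=
    fun p => E.apply_eq_iff_eq (x := cycleMk σ p)
  have hL : blockWeights w g ĥ c = ∑ p, if cycleMk τ (f p) = E c then w p.1 else 0 :=
    Finset.sum_congr rfl fun p _ => if_congr (hE p).symm rfl rfl
  have hR : blockWeights ((fun i => w (some i)) + Pi.single q (w none)) g' h (E c) =
      ∑ p, if cycleMk τ p = E c then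
        ((fun i => w (some i)) + Pi.single q (w none) : α → ℝ≥0∞) p.1 else 0 :=
    rfl
  rw [hL, hR, Fintype.sum_prod_type, Fintype.sum_prod_type, Fintype.sum_option, add_comm]
  have hsplit : ∀ i x, (if cycleMk τ (i, x) = E c then
      ((fun i => w (some i)) + Pi.single q (w none) : α → ℝ≥0∞) i else 0) =
      (if cycleMk τ (i, x) = E c then w (some i) else 0) +
        if i = q then (if cycleMk τ (q, x) = E c then w none else 0) else 0 := by
    intro i x
    by_cases hi : i = q
    · subst hi
      by_cases hc : cycleMk τ (i, x) = E c <;> simp [hc]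
    · simp [hi]
  simp only [hsplit, Finset.sum_add_distrib]
  congr 1
  rw [Finset.sum_comm]
  simp only [Finset.sum_ite_eq', Finset.mem_univ, if_true]
  exact Equiv.sum_comp (g none : Equiv.Perm κ) fun x => if cycleMk τ (q, x) = E c then w none else 0

end Blocks

/-! ### Averages over the wreath product -/

theorem merge_congr {ι ι' κ κ' : Type*} {b : ι → ℝ≥0∞} {b' : ι' → ℝ≥0∞} {a : κ → ℝ≥0∞}
    {a' : κ' → ℝ≥0∞} (hb : ∀ t, countAbove b t = countAbove b' t)
    (ha : ∀ t, countAbove a t = countAbove a' t) : merge b a = merge b' a' := by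
  rw [merge, merge]
  exact ranked_congr fun t => by rw [countAbove_sumElim, countAbove_sumElim, hb, ha]

section Sums

variable {α α' κ : Type*} [Fintype α] [DecidableEq α] [Fintype κ] {Γ : Subgroup (Equiv.Perm κ)}
  [Fintype Γ]

variable (Γ) in
/-- The sum of a function `F` of the ranked cycle weights over all block permutations. -/
noncomputable def blockSum (F : (ℕ → ℝ≥0∞) → ℝ) (w : α → ℝ≥0∞) : ℝ :=
  ∑ h : Equiv.Perm α, ∑ g : α → Γ, F (ranked (blockWeights w g h))

theorem blockSum_relabel [Fintype α'] [DecidableEq α'] (F : (ℕ → ℝ≥0∞) → ℝ) (e : α ≃ α')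
    (w : α' → ℝ≥0∞) : blockSum Γ F (fun i => w (e i)) = blockSum Γ F w := by
  refine (Fintype.sum_equiv e.symm.permCongr _ _ fun h => ?_).symm
  refine Fintype.sum_equiv (e.symm.arrowCongr (Equiv.refl Γ)) _ _ fun g => ?_
  exact congrArg F (ranked_congr fun t => (countAbove_blockWeights_relabel e w g h t).symm)

/-- Splitting the sum over block permutations according to the image of the block `none`. -/
theorem blockSum_option (F : (ℕ → ℝ≥0∞) → ℝ) (w : Option α → ℝ≥0∞) :
    blockSum Γ F w =
      ∑ γ : Γ, blockSum Γ
        (fun y => F (merge (cycleWeight (γ : Equiv.Perm κ) fun _ => w none) y))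
        (fun i => w (some i)) +
      Fintype.card Γ * ∑ q, blockSum Γ F ((fun i => w (some i)) + Pi.single q (w none)) := by
  have hfun : ∀ f : (Option α → Γ) → ℝ,
      ∑ g, f g = ∑ γ : Γ, ∑ g : α → Γ, f fun o => o.elim γ g := by
    intro f
    rw [← Fintype.sum_prod_type']
    refine Fintype.sum_equiv (Equiv.piOptionEquivProd (β := fun _ : Option α => Γ)) _ _ fun g => ?_
    congr 1
    funext o
    rcases o with _ | o <;> rfl
  have h1 : blockSum Γ F w = ∑ p : Option α, ∑ h : Equiv.Perm α, ∑ g : Option α → Γ,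
      F (ranked (blockWeights w g (Equiv.Perm.decomposeOption.symm (p, h)))) := by
    rw [blockSum]
    refine Eq.trans ?_ (Fintype.sum_prod_type (f := fun p : Option α × Equiv.Perm α =>
      ∑ g : Option α → Γ, F (ranked (blockWeights w g (Equiv.Perm.decomposeOption.symm p)))))
    exact (Equiv.sum_comp (Equiv.Perm.decomposeOption (α := α)).symm fun h => ∑ g : Option α → Γ,
      F (ranked (blockWeights w g h))).symm
  rw [h1, Fintype.sum_option]
  congr 1
  · rw [Finset.sum_congr rfl fun h _ => hfun _, Finset.sum_comm]
    refine Finset.sum_congr rfl fun γ _ => Finset.sum_congr rfl fun h _ =>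
      Finset.sum_congr rfl fun g _ => congrArg F ?_
    rw [merge]
    refine ranked_congr fun t => ?_
    rw [countAbove_blockWeights_none, countAbove_sumElim, countAbove_ranked]
    rfl
  · rw [Finset.mul_sum]
    refine Finset.sum_congr rfl fun q _ => ?_
    rw [blockSum, Finset.mul_sum]
    refine Finset.sum_congr rfl fun h _ => ?_
    rw [hfun, ← nsmul_eq_mul, ← Finset.card_univ, ← Finset.sum_const]
    refine Finset.sum_congr rfl fun γ _ => ?_
    -- contracting the block `none` acts on `g` by a translation of the group `α → Γ`
    refine Fintype.sum_equiv (Equiv.mulLeft (Pi.mulSingle (h.symm q) γ)) _ _ fun g => ?_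
    exact congrArg F (ranked_congr fun t => countAbove_blockWeights_some w _ q h t)

variable (Γ) in
/-- The mean of `F` over all block permutations of `n` blocks whose points have weight `c`. -/
noncomputable def blockMean (c : ℝ≥0∞) (n : ℕ) (F : (ℕ → ℝ≥0∞) → ℝ) : ℝ :=
  blockSum Γ F (fun _ : Fin n => c) / (n.factorial * (Fintype.card Γ : ℝ) ^ n)

/-- Exploring the block cycle through one distinguished block, which already stands for `ℓ` blocks,
in the presence of `n` more blocks. -/
theorem blockSum_distinguished (c : ℝ≥0∞) (F : (ℕ → ℝ≥0∞) → ℝ) (n : ℕ) : ∀ ℓ : ℕ,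
    blockSum Γ F (fun o : Option (Fin n) => o.elim (ℓ * c) fun _ => c) /
        (n.factorial * (Fintype.card Γ : ℝ) ^ (n + 1)) =
      ∑ j ∈ Finset.range (n + 1), (∑ γ : Γ, blockMean Γ c (n - j) fun y =>
        F (merge (cycleWeight (γ : Equiv.Perm κ) fun _ => ((ℓ + j : ℕ) : ℝ≥0∞) * c) y)) /
          (Fintype.card Γ : ℝ) := by
  have hΓ : (Fintype.card Γ : ℝ) ≠ 0 := by exact_mod_cast Fintype.card_ne_zero
  have hmean : ∀ (n ℓ : ℕ), (∑ γ : Γ, blockSum Γ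
        (fun y => F (merge (cycleWeight (γ : Equiv.Perm κ) fun _ => (ℓ : ℝ≥0∞) * c) y))
        (fun _ : Fin n => c)) / (n.factorial * (Fintype.card Γ : ℝ) ^ (n + 1)) =
      (∑ γ : Γ, blockMean Γ c n fun y =>
        F (merge (cycleWeight (γ : Equiv.Perm κ) fun _ => (ℓ : ℝ≥0∞) * c) y)) /
          (Fintype.card Γ : ℝ) := by
    intro n ℓ
    simp only [blockMean]
    rw [← Finset.sum_div, div_div, pow_succ, mul_assoc]
  induction n with
  | zero =>
    intro ℓ
    rw [blockSum_option, Finset.univ_eq_empty (α := Fin 0), Finset.sum_empty, mul_zero, add_zero,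
      Finset.sum_range_one]
    exact hmean 0 ℓ
  | succ n ih =>
    intro ℓ
    have hrelabel : ∀ q : Fin (n + 1),
        blockSum Γ F ((fun _ => c) + Pi.single q ((ℓ : ℝ≥0∞) * c) : Fin (n + 1) → ℝ≥0∞) =
          blockSum Γ F (fun o : Option (Fin n) => o.elim (((ℓ + 1 : ℕ) : ℝ≥0∞) * c) fun _ => c) := by
      intro q
      rw [← blockSum_relabel F (finSuccEquiv' q)]
      congr 1
      funext i
      rcases eq_or_ne i q with rfl | hi
      · simp only [Pi.add_apply, Pi.single_eq_same, finSuccEquiv'_at, Option.elim]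
        push_cast
        ring
      · obtain ⟨i', rfl⟩ := Fin.exists_succAbove_eq hi
        simp [hi]
    rw [blockSum_option, add_div, Finset.sum_range_succ']
    simp only [Option.elim]
    rw [Finset.sum_congr rfl fun q _ => hrelabel q, Finset.sum_const, Finset.card_univ,
      Fintype.card_fin, add_comm, hmean, nsmul_eq_mul, Nat.sub_zero, Nat.add_zero]
    congr 1
    have h := ih (ℓ + 1)
    have hfac : ((n.factorial : ℕ) : ℝ) ≠ 0 := by exact_mod_cast n.factorial_ne_zero
    have hn : ((n + 1 : ℕ) : ℝ) ≠ 0 := by positivity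
    have hcancel : ∀ S : ℝ, (Fintype.card Γ : ℝ) * (((n + 1 : ℕ) : ℝ) * S) /
        ((n + 1).factorial * (Fintype.card Γ : ℝ) ^ (n + 1 + 1)) =
        S / (n.factorial * (Fintype.card Γ : ℝ) ^ (n + 1)) := by
      intro S
      rw [Nat.factorial_succ, Nat.cast_mul, pow_succ _ (n + 1)]
      field_simp
    rw [hcancel, h]
    refine Finset.sum_congr rfl fun j _ => ?_
    rw [Nat.add_sub_add_right, add_assoc, add_comm 1 j]

theorem blockMean_succ (c : ℝ≥0∞) (F : (ℕ → ℝ≥0∞) → ℝ) (N : ℕ) :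
    (N + 1 : ℝ) * blockMean Γ c (N + 1) F =
      ∑ j ∈ Finset.range (N + 1), (∑ γ : Γ, blockMean Γ c (N - j) fun y =>
        F (merge (cycleWeight (γ : Equiv.Perm κ) fun _ => ((j + 1 : ℕ) : ℝ≥0∞) * c) y)) /
          (Fintype.card Γ : ℝ) := by
  have h := blockSum_distinguished (Γ := Γ) c F N 1
  simp only [add_comm 1] at h
  rw [← h, blockMean, ← blockSum_relabel F (finSuccEquiv N)]
  have hw : (fun i : Fin (N + 1) => (finSuccEquiv N i).elim (((1 : ℕ) : ℝ≥0∞) * c) fun _ => c)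
      = fun _ => c := by
    funext i
    refine Fin.cases ?_ (fun i => ?_) i <;> simp
  rw [hw, Nat.factorial_succ, Nat.cast_mul]
  have hfac : ((N.factorial : ℕ) : ℝ) ≠ 0 := by exact_mod_cast N.factorial_ne_zero
  have hΓ : (Fintype.card Γ : ℝ) ≠ 0 := by exact_mod_cast Fintype.card_ne_zero
  push_cast
  field_simp

end Sums

/-! ### Uniform permutations in the wreath product -/

theorem integral_uniformOn_range {Ω I : Type*} [MeasurableSpace Ω] [DiscreteMeasurableSpace Ω]
    [Finite Ω] [Fintype I] {φ : I → Ω} (hφ : Function.Injective φ) (f : Ω → ℝ) :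
    ∫ x, f x ∂(uniformOn (Set.range φ)) = (∑ i, f (φ i)) / Fintype.card I := by
  classical
  have hrange : Set.range φ = (Finset.univ.image φ : Finset Ω) := by simp
  have hcard : (Finset.univ.image φ).card = Fintype.card I := by
    rw [Finset.card_image_of_injective _ hφ, Finset.card_univ]
  rw [uniformOn, ProbabilityTheory.cond, integral_smul_measure, hrange, setIntegral_finset,
    Measure.count_apply_finset, hcard, Finset.sum_image fun _ _ _ _ h => hφ h]
  · simp [Measure.real, div_eq_inv_mul]
  · exact IntegrableOn.finset

theorem blockPerm_injective {α κ : Type*} [Nonempty κ] {Γ : Subgroup (Equiv.Perm κ)} :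
    Function.Injective fun p : (α → Γ) × Equiv.Perm α => blockPerm p.1 p.2 := by
  rintro ⟨g, h⟩ ⟨g', h'⟩ heq
  have hpt : ∀ i x, (h i, (g i : Equiv.Perm κ) x) = (h' i, (g' i : Equiv.Perm κ) x) :=
    fun i x => Equiv.congr_fun heq (i, x)
  obtain ⟨x₀⟩ := ‹Nonempty κ›
  refine Prod.ext (funext fun i => Subtype.ext (Equiv.ext fun x => ?_)) (Equiv.ext fun i => ?_)
  · exact congrArg Prod.snd (hpt i x)
  · exact congrArg Prod.fst (hpt i x₀)

section

variable {m : ℕ} (Γ : Subgroup (Equiv.Perm (Fin m)))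

theorem wreathProduct_eq_range (n : ℕ) :
    (wreathProduct Γ n : Set (Equiv.Perm (Fin n × Fin m))) =
      Set.range fun p : (Fin n → Γ) × Equiv.Perm (Fin n) => blockPerm p.1 p.2 := by
  ext σ
  constructor
  · rintro ⟨g, h, hσ⟩
    exact ⟨(g, h), Equiv.ext fun p => (hσ p.1 p.2).symm⟩
  · rintro ⟨⟨g, h⟩, rfl⟩
    exact ⟨g, h, fun _ _ => rfl⟩

/-- The law of the ranked cycle lengths, in units of the block size, of a uniform element of the
wreath product. -/
noncomputable def cycleLaw (n : ℕ) : Measure (ℕ → ℝ≥0∞) :=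
  (uniformOn (wreathProduct Γ n : Set (Equiv.Perm (Fin n × Fin m)))).map
    fun π => ranked fun c : Cycles π => (m : ℝ≥0∞)⁻¹ * cycleLength π c

instance isProbabilityMeasure_cycleLaw (n : ℕ) : IsProbabilityMeasure (cycleLaw Γ n) :=
  Measure.isProbabilityMeasure_map (Measurable.of_discrete).aemeasurable

theorem integral_cycleLaw [NeZero m] [Fintype Γ] (n : ℕ) {F : (ℕ → ℝ≥0∞) → ℝ}
    (hF : Measurable F) : ∫ y, F y ∂cycleLaw Γ n = blockMean Γ (m : ℝ≥0∞)⁻¹ n F := by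
  rw [cycleLaw, integral_map (Measurable.of_discrete).aemeasurable hF.aestronglyMeasurable,
    wreathProduct_eq_range, integral_uniformOn_range blockPerm_injective, blockMean, blockSum,
    Fintype.card_prod, Fintype.card_fun, Fintype.card_perm, Fintype.card_fin,
    Fintype.sum_prod_type, Finset.sum_comm, Nat.cast_mul, Nat.cast_pow, mul_comm]
  congr 1
  refine Finset.sum_congr rfl fun h _ => Finset.sum_congr rfl fun g _ => ?_
  rw [blockWeights, funext (cycleWeight_const (blockPerm g h) _)]

theorem measurable_cyclePartition :
    Measurable (cyclePartition : Equiv.Perm (Fin m) → ℕ → ℝ≥0∞) :=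
  Measurable.of_discrete

/-- The cycle through a given block is a uniform fraction of all blocks: the law of the cycle
lengths satisfies the recursion of splitting off a cycle. -/
theorem isSplitRecursion_cycleLaw [NeZero m] :
    IsSplitRecursion ((uniformOn (Γ : Set (Equiv.Perm (Fin m)))).map cyclePartition)
      (cycleLaw Γ) := by
  classical
  have : Fintype Γ := Fintype.ofFinite Γ
  refine ⟨?_, fun N F hF hb => ?_⟩
  · have h0 : (fun π : Equiv.Perm (Fin 0 × Fin m) =>
        ranked fun c : Cycles π => (m : ℝ≥0∞)⁻¹ * cycleLength π c) = fun _ => 0 := by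
      funext π
      have : IsEmpty (Cycles π) := Quotient.instIsEmpty
      exact ranked_eq_zero_of_isEmpty _
    rw [cycleLaw, h0, Measure.map_const, measure_univ, one_smul]
  · have hmb : ∀ j : ℕ, Measurable fun p : (ℕ → ℝ≥0∞) × (ℕ → ℝ≥0∞) =>
        F (merge (fun i => ((j + 1 : ℕ) : ℝ≥0∞) * p.1 i) p.2) := by
      intro j
      have h1 : Measurable fun p : (ℕ → ℝ≥0∞) × (ℕ → ℝ≥0∞) =>
          fun i => ((j + 1 : ℕ) : ℝ≥0∞) * p.1 i := measurable_pi_lambda _ fun i => by fun_prop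
      exact hF.comp (h1.merge measurable_snd)
    rw [integral_cycleLaw Γ _ hF, blockMean_succ]
    refine Finset.sum_congr rfl fun j _ => ?_
    have hrange : (Γ : Set (Equiv.Perm (Fin m))) = Set.range (Subtype.val : Γ → _) :=
      Subtype.range_coe.symm
    rw [integral_map measurable_cyclePartition.aemeasurable
      (hmb j).stronglyMeasurable.integral_prod_right'.aestronglyMeasurable, hrange,
      integral_uniformOn_range Subtype.val_injective]
    congr 1
    refine Finset.sum_congr rfl fun γ _ => ?_
    rw [integral_cycleLaw Γ _ (F := fun y => F (merge
      (fun i => ((j + 1 : ℕ) : ℝ≥0∞) * cyclePartition (γ : Equiv.Perm (Fin m)) i) y))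
      (hF.comp (measurable_merge_right _))]
    congr 1
    funext y
    refine congrArg F (merge_congr (fun t => ?_) fun _ => rfl)
    rw [cyclePartition, countAbove_const_mul_congr (ENNReal.natCast_ne_top _)
      (countAbove_ranked _), funext (cycleWeight_const (γ : Equiv.Perm (Fin m)) _)]
    simp only [Nat.card_eq_fintype_card, Fintype.card_fin, div_eq_mul_inv, mul_assoc,
      mul_comm (m : ℝ≥0∞)⁻¹]

theorem tsum_cyclePartition [NeZero m] (σ : Equiv.Perm (Fin m)) :
    ∑' i, cyclePartition σ i = 1 := by
  classical
  have : Fintype (Cycles σ) := Fintype.ofFinite _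
  rw [cyclePartition, tsum_ranked, tsum_fintype]
  simp only [div_eq_mul_inv, Nat.card_eq_fintype_card, Fintype.card_fin]
  rw [← Finset.sum_mul]
  have h1 : ∀ c, (cycleLength σ c : ℝ≥0∞) = cycleWeight σ (fun _ => 1) c := fun c => by
    rw [cycleWeight_const, one_mul]
  simp only [h1, cycleWeight]
  rw [Finset.sum_comm]
  simp only [Finset.sum_ite_eq, Finset.mem_univ, if_true, Finset.sum_const, Finset.card_univ,
    Fintype.card_fin, nsmul_eq_mul, mul_one]
  exact ENNReal.mul_inv_cancel (by exact_mod_cast NeZero.ne m) (ENNReal.natCast_ne_top m)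

end

theorem tendstoInDistribution_kthCycle {m : ℕ} [NeZero m] (Γ : Subgroup (Equiv.Perm (Fin m)))
    {𝒜 : ProbabilityMeasure (ℕ → ℝ≥0∞)}
    (hβ : ∀ᵐ b ∂((uniformOn (Γ : Set (Equiv.Perm (Fin m)))).map cyclePartition), ∑' i, b i = 1)
    (hA : IsSelfSimilarPartition
      ((uniformOn (Γ : Set (Equiv.Perm (Fin m)))).map cyclePartition) 𝒜) {k : ℕ} (hk : 1 ≤ k) :
    TendstoInDistribution
      (fun (n : ℕ) (π : Equiv.Perm (Fin n × Fin m)) =>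
        (kthCycle π k).toReal / ((m : ℝ) * (n : ℝ)))
      atTop
      (fun a : ℕ → ℝ≥0∞ => (kthLargest a k).toReal)
      (fun n => uniformOn (wreathProduct Γ n : Set (Equiv.Perm (Fin n × Fin m))))
      (𝒜 : Measure (ℕ → ℝ≥0∞)) := by
  have hX : ∀ n, AEMeasurable (fun π : Equiv.Perm (Fin n × Fin m) =>
      (kthCycle π k).toReal / ((m : ℝ) * (n : ℝ)))
      (uniformOn (wreathProduct Γ n : Set (Equiv.Perm (Fin n × Fin m)))) :=
    fun n => (Measurable.of_discrete).aemeasurable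
  have hZ : Measurable fun a : ℕ → ℝ≥0∞ => (kthLargest a k).toReal :=
    (measurable_kthLargest k).ennreal_toReal
  have : IsProbabilityMeasure ((uniformOn (Γ : Set (Equiv.Perm (Fin m)))).map cyclePartition) :=
    Measure.isProbabilityMeasure_map measurable_cyclePartition.aemeasurable
  refine ⟨hX, hZ.aemeasurable, tendsto_iff_forall_lipschitz_integral_tendsto.mpr ?_⟩
  rintro f hb ⟨L, hL⟩
  have h := (isSplitRecursion_cycleLaw Γ).tendsto_integral_term hβ hA (k - 1) hL hb
  have hlim : ∫ a, f (a (k - 1)).toReal ∂(𝒜 : Measure (ℕ → ℝ≥0∞))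
      = ∫ x, f x ∂((𝒜 : Measure (ℕ → ℝ≥0∞)).map fun a => (kthLargest a k).toReal) := by
    rw [integral_map hZ.aemeasurable hL.continuous.aestronglyMeasurable]
    refine integral_congr_ae ?_
    filter_upwards [hA.1] with a ha
    rw [kthLargest_eq_of_antitone ha.1 hk]
  rw [hlim] at h
  refine h.congr fun n => ?_
  have hmeas : Measurable fun y : ℕ → ℝ≥0∞ => f ((y (k - 1)).toReal / n) :=
    hL.continuous.measurable.comp
      (((measurable_pi_apply (k - 1)).ennreal_toReal).div_const _)
  rw [cycleLaw, integral_map (Measurable.of_discrete).aemeasurable hmeas.aestronglyMeasurable]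
  refine Eq.trans ?_ (integral_map (hX n) hL.continuous.aestronglyMeasurable).symm
  refine integral_congr_ae (.of_forall fun π => congrArg f ?_)
  have hkey : ranked (fun c : Cycles π => (m : ℝ≥0∞)⁻¹ * cycleLength π c) (k - 1)
      = (m : ℝ≥0∞)⁻¹ * kthCycle π k := by
    rw [ranked, Nat.sub_add_cancel hk, kthLargest_const_mul _ _ hk, kthCycle]
    exact ENNReal.inv_ne_top.mpr (by exact_mod_cast NeZero.ne m)
  rw [hkey, ENNReal.toReal_mul, ENNReal.toReal_inv, ENNReal.toReal_natCast, mul_comm,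
    ← div_eq_mul_inv, div_div]

end WreathCycles

theorem mainTheorem7 (m : ℕ) (hm : 0 < m) (Γ : Subgroup (Equiv.Perm (Fin m))) :
    -- the law of `𝒜` is well defined by `𝒜 = (U ℬ, (1 - U) 𝒜)`
    (∃! 𝒜 : ProbabilityMeasure (ℕ → ℝ≥0∞),
      IsSelfSimilarPartition ((uniformOn (Γ : Set (Equiv.Perm (Fin m)))).map cyclePartition) 𝒜) ∧
    ∀ 𝒜 : ProbabilityMeasure (ℕ → ℝ≥0∞),
      IsSelfSimilarPartition ((uniformOn (Γ : Set (Equiv.Perm (Fin m)))).map cyclePartition) 𝒜 →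
      ∀ k : ℕ, 1 ≤ k →
        -- `C_k / (m n)` converges in distribution to `𝒜_k`
        TendstoInDistribution
          (fun (n : ℕ) (π : Equiv.Perm (Fin n × Fin m)) =>
            (kthCycle π k).toReal / ((m : ℝ) * (n : ℝ)))
          atTop
          (fun a : ℕ → ℝ≥0∞ => (kthLargest a k).toReal)
          (fun n => uniformOn (wreathProduct Γ n : Set (Equiv.Perm (Fin n × Fin m))))
          (𝒜 : Measure (ℕ → ℝ≥0∞)) ∧
        -- the initial condition
        (∀ u ∈ Set.Icc (0 : ℝ) 1, phi 𝒜 k u = 1) ∧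
        -- the two forms of the recursion
        ∀ u : ℝ, 0 < u →
          phi 𝒜 k u = (1 / u) * ∑ j ∈ Finset.range k,
            ∫ g, (∫ y in
                (ENNReal.ofReal u - 1 / kthLargest (cyclePartition g) (j + 1)).toReal..
                (ENNReal.ofReal u - 1 / kthLargest (cyclePartition g) j).toReal,
                phi 𝒜 (k - j) y)
              ∂(uniformOn (Γ : Set (Equiv.Perm (Fin m)))) ∧
          u * phi 𝒜 k u = ∑ j ∈ Finset.range k,
            ∫ x in (0 : ℝ)..u,
              (uniformOn (Γ : Set (Equiv.Perm (Fin m)))).real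
                {g | kthLargest (cyclePartition g) (j + 1) ≤ 1 / ENNReal.ofReal x ∧
                  1 / ENNReal.ofReal x < kthLargest (cyclePartition g) j} *
              phi 𝒜 (k - j) (u - x) := by
  have : NeZero m := ⟨hm.ne'⟩
  have hB := measurable_cyclePartition (m := m)
  have : IsProbabilityMeasure ((uniformOn (Γ : Set (Equiv.Perm (Fin m)))).map cyclePartition) :=
    Measure.isProbabilityMeasure_map hB.aemeasurable
  have hβ : ∀ᵐ b ∂((uniformOn (Γ : Set (Equiv.Perm (Fin m)))).map cyclePartition),
      ∑' i, b i = 1 :=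
    (ae_map_iff hB.aemeasurable
      (measurableSet_eq_fun (by fun_prop) measurable_const)).mpr (.of_forall tsum_cyclePartition)
  refine ⟨?_, fun 𝒜 hA k hk => ⟨tendstoInDistribution_kthCycle Γ hβ hA hk,
    fun u hu => phi_eq_one hA hk hu.2, fun u hu => ?_⟩⟩
  · obtain ⟨𝒜, hA⟩ := exists_isSelfSimilarPartition hβ
    exact ⟨𝒜, hA, fun 𝒜' hA' =>
      (isSplitRecursion_cycleLaw Γ).isSelfSimilarPartition_unique hβ hA' hA⟩
  · have hconv := hA.mul_phi_eq hB hk hu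
    refine ⟨?_, hconv⟩
    rw [one_div, eq_inv_mul_iff_mul_eq₀ hu.ne', hconv]
    exact Finset.sum_congr rfl fun j _ => integral_between_mul_eq hB j hu
      (antitone_phi 𝒜 _) (phi_nonneg 𝒜 _) (phi_le_one 𝒜 _)
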